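/- **Models.** A *non-probabilistic simulation model* is a deterministic Turing machine with finitely many states and one binary memory tape whose squares are indexed by $\mathbb N$. A *probabilistic simulation model* is such a machine that in addition has read access to a random bit tape $\mathbf r\in\{0,1\}^{\mathbb N}$. Machines are started on the empty (all-$0$) memory tape. An *intervention* $\alpha$ is a conjunction $l_{i_1}\wedge\dots\wedge l_{i_n}$ ($n\ge 0$, $i_1<\dots<i_n$) of literals, $l_{i}\in\{X_i,\neg X_i\}$. The intervened machine $\mathcal I_\alpha(\mathsf T)$ first writes the values specified by $\alpha$ on the squares $i_1,\dots,i_n$ and then runs $\mathsf T$, ignoring all writes to these squares. Let $\mathcal M$ be the class of all probabilistic simulation models, and $\mathcal M^{\downarrow}$ the class of those $\mathsf T$ for which $\mathcal I_\alpha(\mathsf T)$ halts with probability $1$ for every intervention $\alpha$, where the bits of $\mathbf r$ are independent fair coin flips. Let $\mathcal M^{\downarrow}_{\mathrm{non\text{-}prob}}$ be the class of non-probabilistic models that halt under every intervention. **Languages.** $\mathcal L_{\mathrm{prop}}$ is the language of propositional formulas (built with $\top,\neg,\wedge,\vee$) over the atoms $X_0,X_1,X_2,\dots$, where $X_i$ says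 that memory square $i$ holds a $1$. $\mathcal L_{\mathrm{non\text{-}prob}}$ is the language of propositional formulas over the atoms $\langle\alpha\rangle\beta$ with $\alpha$ an intervention and $\beta\in\mathcal L_{\mathrm{prop}}$. The atom $\langle\alpha\rangle\beta$ is true in a non-probabilistic $\mathsf T$ (respectively, in a probabilistic $\mathsf T$ with fixed random tape $\mathbf r$) iff $\mathcal I_\alpha(\mathsf T)$ (run with random tape $\mathbf r$) halts with a memory tape satisfying $\beta$; the connectives have their usual meaning. $\mathcal L$ is the language of propositional formulas over the atoms $a_1\mathbb P(\varphi_1)+\dots+a_n\mathbb P(\varphi_n)\le c$ with $n\in\mathbb N$, $a_i,c\in\mathbb Z$, $\varphi_i\in\mathcal L_{\mathrm{non\text{-}prob}}$. Such an atom is true in a probabilistic $\mathsf T$ iff the inequality holds when $\mathbb P(\varphi)$ takes the value $\mathbb P_{\mathsf T}(\varphi)=\mu\{\mathbf r:\mathsf T,\mathbf r\models\varphi\}$, with $\mu$ the fair-coin product measure on $\{0,1\}^{\mathbb N}$. Write $\models_{\mathrm{non\text{-}prob}}\varphi$ (respectively, $\models^{\downarrow}_{\mathrm{non\text{-}prob}}\varphi$)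 if $\varphi\in\mathcal L_{\mathrm{non\text{-}prob}}$ is true in all non-probabilistic models (respectively, in all of $\mathcal M^{\downarrow}_{\mathrm{non\text{-}prob}}$). As usual, $\varphi\to\psi$ is $\neg\varphi\vee\psi$, $\varphi\leftrightarrow\psi$ is $(\varphi\to\psi)\wedge(\psi\to\varphi)$, and for a sum $t$ of terms $a_i\mathbb P(\varphi_i)$, $t\ge c$ is $-t\le -c$, $t<c$ is $\neg(t\ge c)$, $t=c$ is $(t\le c)\wedge(t\ge c)$, with terms moved to the left-hand side where necessary. **Axioms.** $\mathsf{AX}$ consists of all propositional tautologies over the atoms of $\mathcal L$, the rule of modus ponens, and all instances of the following axioms, in which $t=\sum_{i=1}^n a_i\mathbb P(\varphi_i)$ and $t'=\sum_{i=1}^n a_i'\mathbb P(\varphi_i)$ with $n\ge 0$, and all coefficients and bounds are integers: * NonNeg: $\mathbb P(\varphi)\ge 0$. Norm: $\mathbb P(\top)=1$. Add: $\mathbb P(\varphi\wedge\psi)+\mathbb P(\varphi\wedge\neg\psi)=\mathbb P(\varphi)$. Dist: $\mathbb P(\varphi)=\mathbb P(\psi)$ whenever $\models_{\mathrm{non\text{-}prob}}\varphi\leftrightarrow\psi$.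 * Zero: $(t\le c)\leftrightarrow(t+0\,\mathbb P(\varphi_{n+1})\le c)$. Permutation: $(t\le c)\leftrightarrow(\sum_{i=1}^n a_{j_i}\mathbb P(\varphi_{j_i})\le c)$ for every permutation $j_1,\dots,j_n$ of $1,\dots,n$. AddIneq: $(t\le c)\wedge(t'\le c')\to(\sum_{i=1}^n (a_i+a_i')\mathbb P(\varphi_i)\le c+c')$. Mult: $(t\le c)\to(\sum_{i=1}^n ba_i\mathbb P(\varphi_i)\le bc)$ for $b>0$. Dichotomy: $(t\le c)\vee(t\ge c)$. Mono: $(t\le c)\to(t<b)$ for $b>c$. $\mathsf{AX}^{\downarrow}$ is the same system with $\models^{\downarrow}_{\mathrm{non\text{-}prob}}$ in place of $\models_{\mathrm{non\text{-}prob}}$ in Dist. **Theorem.** For every $\varphi\in\mathcal L$: $\varphi$ is provable in $\mathsf{AX}$ if and only if $\mathsf T\models\varphi$ for all $\mathsf T\in\mathcal M$; and $\varphi$ is provable in $\mathsf{AX}^{\downarrow}$ if and only if $\mathsf T\models\varphi$ for all $\mathsf T\in\mathcal M^{\downarrow}$. -/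

import Mathlib

open MeasureTheory

namespace ProbSim

/-! ### Propositional languages over a set of atoms -/

/-- The propositional formulas over the atoms `A`: the closure of `A` under negation,
(possibly empty) conjunction and disjunction. -/
inductive Fml (A : Type) : Type
  | atom : A → Fml A
  | top : Fml A
  | neg : Fml A → Fml A
  | and : Fml A → Fml A → Fml A
  | or : Fml A → Fml A → Fml A

namespace Fml

/-- `φ → ψ` abbreviates `¬ φ ∨ ψ`. -/
def imp {A : Type} (φ ψ : Fml A) : Fml A := or (neg φ) ψ

/-- `φ ↔ ψ` abbreviates `(φ → ψ) ∧ (ψ → φ)`. -/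
def iff {A : Type} (φ ψ : Fml A) : Fml A := and (imp φ ψ) (imp ψ φ)

/-- Truth of a formula, given which atoms are true. -/
def Holds {A : Type} (v : A → Prop) : Fml A → Prop
  | atom a => v a
  | top => True
  | neg φ => ¬ Holds v φ
  | and φ ψ => Holds v φ ∧ Holds v ψ
  | or φ ψ => Holds v φ ∨ Holds v ψ

/-- A propositional tautology: true under every valuation of the atoms. -/
def Tautology {A : Type} (φ : Fml A) : Prop := ∀ v : A → Prop, Holds v φ

end Fml

/-! ### The basic language -/

/-- Propositional formulas over the memory tape variables; the atom `i : ℕ` is `X_i`, which says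
that memory square `i` holds a `1`. -/
abbrev LProp : Type := Fml ℕ

/-- Intervention specifications: ordered conjunctions `l_{i_1} ∧ … ∧ l_{i_n}`, `n ≥ 0`,
`i_1 < … < i_n`, of literals. The pair `(i, true)` is the literal `X_i` and `(i, false)` is
`¬ X_i`. -/
structure LInt : Type where
  literals : List (ℕ × Bool)
  ordered : literals.Pairwise fun l l' => l.1 < l'.1

/-- The value to which an intervention holds square `i`, if it holds it to any. -/
def LInt.value (α : LInt) (i : ℕ) : Option Bool := α.literals.lookup i

/-- The subjunctive conditionals `⟨α⟩ β`. -/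
structure LCond : Type where
  antecedent : LInt
  consequent : LProp

/-- The basic language: propositional formulas over conditionals. -/
abbrev LNonProb : Type := Fml LCond

/-! ### Simulation models

Memory tapes are sequences `ℕ → Bool`; the empty tape holds `0` (`false`) everywhere. -/

/-- Head moves. -/
inductive Move : Type
  | left
  | stay
  | right

/-- The new head position; a left move at the left end of a tape leaves the head in place. -/
def Move.apply : Move → ℕ → ℕ
  | left, i => i - 1
  | stay, i => i
  | right, i => i + 1

/-- The memory tape at the start of a run under the intervention `α`: the empty tape with the
values specified by `α` written on it. -/
def initTape (α : LInt) : ℕ → Bool := fun i => (α.value i).getD false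

/-- Writing `b` to square `i` under the intervention `α`: a write to a square held by `α` is
ignored. -/
def writeUnder (α : LInt) (tape : ℕ → Bool) (i : ℕ) (b : Bool) : ℕ → Bool :=
  if (α.value i).isSome then tape else Function.update tape i b

/-- A non-probabilistic simulation model: a deterministic Turing machine with a binary memory
tape. From its state and the scanned bit it either halts (`none`) or enters a new state, writes a
bit and moves its head. -/
structure NonProbModel : Type 1 where
  State : Type
  finite_state : Finite State
  start : State
  trans : State → Bool → Option (State × Bool × Move)

namespace NonProbModel

structure Config (T : NonProbModel) : Type where
  state : T.State
  tape : ℕ → Bool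
  head : ℕ

/-- The initial configuration of `T` under the intervention `α`. -/
def init (T : NonProbModel) (α : LInt) : T.Config := ⟨T.start, initTape α, 0⟩

/-- One step of `T` under the intervention `α`. -/
def step (T : NonProbModel) (α : LInt) (c : T.Config) : Option T.Config :=
  (T.trans c.state (c.tape c.head)).map fun (q, b, m) =>
    ⟨q, writeUnder α c.tape c.head b, m.apply c.head⟩

/-- `T` under the intervention `α` halts with the memory tape `t`. -/
def HaltsWith (T : NonProbModel) (α : LInt) (t : ℕ → Bool) : Prop :=
  ∃ c ∈ StateTransition.eval (T.step α) (T.init α), c.tape = t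

/-- Satisfaction of formulas of the basic language in a non-probabilistic model. -/
def Sat (T : NonProbModel) (φ : LNonProb) : Prop :=
  φ.Holds fun a => ∃ t, T.HaltsWith a.antecedent t ∧ a.consequent.Holds fun i => t i = true

/-- The models that halt under every intervention. -/
def AlwaysHalting (T : NonProbModel) : Prop := ∀ α : LInt, ∃ t, T.HaltsWith α t

end NonProbModel

/-- A probabilistic simulation model: a deterministic Turing machine with a binary memory tape
and a read-only head on a random bit tape. From its state, the scanned memory bit and the scanned
random bit it either halts (`none`) or enters a new state, writes a memory bit, moves its memory
head and moves its random tape head. -/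
structure ProbModel : Type 1 where
  State : Type
  finite_state : Finite State
  start : State
  trans : State → Bool → Bool → Option (State × Bool × Move × Move)

/-- The standard measure on infinite bit sequences: the product of fair coin measures. -/
noncomputable def coinMeasure : Measure (ℕ → Bool) :=
  Measure.infinitePi fun _ : ℕ => (PMF.uniformOfFintype Bool).toMeasure

/-- The formulas `a_1 P(φ_1) + … + a_n P(φ_n) ≤ c` with integers `a_i` and `c`. -/
structure LIneq : Type where
  terms : List (ℤ × LNonProb)
  bound : ℤ

/-- The probabilistic language: propositional formulas over linear inequalities. -/
abbrev L : Type := Fml LIneq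

namespace ProbModel

structure Config (T : ProbModel) : Type where
  state : T.State
  tape : ℕ → Bool
  head : ℕ
  randHead : ℕ

/-- The initial configuration of `T` under the intervention `α`. -/
def init (T : ProbModel) (α : LInt) : T.Config := ⟨T.start, initTape α, 0, 0⟩

/-- One step of `T` under the intervention `α`, with random bit tape `r`. -/
def step (T : ProbModel) (α : LInt) (r : ℕ → Bool) (c : T.Config) : Option T.Config :=
  (T.trans c.state (c.tape c.head) (r c.randHead)).map fun (q, b, m, m') =>
    ⟨q, writeUnder α c.tape c.head b, m.apply c.head, m'.apply c.randHead⟩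

/-- `T` under the intervention `α`, with random bit tape `r`, halts with the memory tape `t`. -/
def HaltsWith (T : ProbModel) (α : LInt) (r : ℕ → Bool) (t : ℕ → Bool) : Prop :=
  ∃ c ∈ StateTransition.eval (T.step α r) (T.init α), c.tape = t

/-- `T, r ⊨ φ` for a formula `φ` of the basic language. -/
def SatWith (T : ProbModel) (r : ℕ → Bool) (φ : LNonProb) : Prop :=
  φ.Holds fun a => ∃ t, T.HaltsWith a.antecedent r t ∧ a.consequent.Holds fun i => t i = true

/-- The probability `P_T(φ)`. -/
noncomputable def prob (T : ProbModel) (φ : LNonProb) : ℝ :=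
  coinMeasure.real {r | T.SatWith r φ}

/-- `T ⊨ φ` for a formula `φ` of the probabilistic language. -/
def Sat (T : ProbModel) (φ : L) : Prop :=
  φ.Holds fun e => (e.terms.map fun p => (p.1 : ℝ) * T.prob p.2).sum ≤ (e.bound : ℝ)

/-- The models that halt with probability one under every intervention. -/
def AlmostSurelyHalting (T : ProbModel) : Prop :=
  ∀ α : LInt, ∀ᵐ r ∂coinMeasure, ∃ t, T.HaltsWith α r t

end ProbModel

/-! ### Validity -/

/-- Validity of a formula of the basic language in all non-probabilistic models. -/
def NonProbValid (φ : LNonProb) : Prop := ∀ T : NonProbModel, T.Sat φ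

/-- Validity of a formula of the basic language in the always halting non-probabilistic models. -/
def NonProbValidHalting (φ : LNonProb) : Prop :=
  ∀ T : NonProbModel, T.AlwaysHalting → T.Sat φ

/-- Validity of a formula of the probabilistic language in all probabilistic models. -/
def Valid (φ : L) : Prop := ∀ T : ProbModel, T.Sat φ

/-- Validity of a formula of the probabilistic language in the almost surely halting
probabilistic models. -/
def ValidHalting (φ : L) : Prop := ∀ T : ProbModel, T.AlmostSurelyHalting → T.Sat φ

/-! ### The axiom systems -/

/-- `a_1 P(φ_1) + … + a_n P(φ_n) ≤ c`. -/
def le (t : List (ℤ × LNonProb)) (c : ℤ) : L := .atom ⟨t, c⟩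

/-- `t ≥ c` stands for `- t ≤ - c`. -/
def ge (t : List (ℤ × LNonProb)) (c : ℤ) : L := le (t.map fun p => (-p.1, p.2)) (-c)

/-- `t < c` stands for `¬ (t ≥ c)`. -/
def lt (t : List (ℤ × LNonProb)) (c : ℤ) : L := .neg (ge t c)

/-- `t = c` stands for `(t ≤ c) ∧ (t ≥ c)`. -/
def eq (t : List (ℤ × LNonProb)) (c : ℤ) : L := .and (le t c) (ge t c)

/-- Derivability in the axiom system whose distribution axiom refers to the notion of validity
`V` for the basic language. Equations between sums of probabilities have all their terms moved to
the left-hand side. -/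
inductive Derivable (V : LNonProb → Prop) : L → Prop
  | taut (φ : L) : φ.Tautology → Derivable V φ
  | mp (φ ψ : L) : Derivable V (φ.imp ψ) → Derivable V φ → Derivable V ψ
  | nonNeg (φ : LNonProb) : Derivable V (ge [(1, φ)] 0)
  | norm : Derivable V (eq [(1, .top)] 1)
  | add (φ ψ : LNonProb) :
      Derivable V (eq [(1, φ.and ψ), (1, φ.and ψ.neg), (-1, φ)] 0)
  | dist (φ ψ : LNonProb) : V (φ.iff ψ) → Derivable V (eq [(1, φ), (-1, ψ)] 0)
  | zero (t : List (ℤ × LNonProb)) (φ : LNonProb) (c : ℤ) :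
      Derivable V ((le t c).iff (le (t ++ [(0, φ)]) c))
  | permutation (t t' : List (ℤ × LNonProb)) (c : ℤ) : t.Perm t' →
      Derivable V ((le t c).iff (le t' c))
  /- each entry `(a, a', φ)` of `t` contributes `a P(φ)` to the first sum and `a' P(φ)` to the
  second -/
  | addIneq (t : List (ℤ × ℤ × LNonProb)) (c c' : ℤ) :
      Derivable V
        (((le (t.map fun p => (p.1, p.2.2)) c).and (le (t.map fun p => (p.2.1, p.2.2)) c')).imp
          (le (t.map fun p => (p.1 + p.2.1, p.2.2)) (c + c')))
  | mult (t : List (ℤ × LNonProb)) (b c : ℤ) : 0 < b →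
      Derivable V ((le t c).imp (le (t.map fun p => (b * p.1, p.2)) (b * c)))
  | dichotomy (t : List (ℤ × LNonProb)) (c : ℤ) : Derivable V ((le t c).or (ge t c))
  | mono (t : List (ℤ × LNonProb)) (b c : ℤ) : c < b →
      Derivable V ((le t c).imp (lt t b))

/-- Provability in `AX`. -/
def AX (φ : L) : Prop := Derivable NonProbValid φ

/-- Provability in `AX↓`. -/
def AXHalting (φ : L) : Prop := Derivable NonProbValidHalting φ

end ProbSim

/-! Soundness rests on transferring validities of the basic language to a probabilistic machine with
a fixed random tape. A halting run reads only finitely many random bits, and a finite prefix can be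
stored in the finite control of a non-probabilistic machine. If that machine loops on leaving the
prefix, it satisfies the same given formula as the original (`satWith_of_nonProbValid`). In the
halting case it must stop instead. It then halts under every intervention because each prefix has
positive measure, and it agrees with the original on almost every tape
(`satWith_of_nonProbValidHalting`).

For completeness, compactness extends a non-derivable formula to a valuation of the inequalities
that verifies all theorems and refutes the formula. By the linear axioms, this valuation depends
only on the total coefficients and so defines a total, additively closed notion of "at most `0`" on
the free abelian group of formulas. Add and Dist reduce each relevant sum to a combination of state
descriptions, that is, to a vector in `ℤⁿ`. The preorder need not be Archimedean, but only finitely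
many signs matter, and Fourier–Motzkin elimination realizes these by rational weights
(`exists_linear_form_sign`). Nonnegativity and nontriviality of the weights are among the signs
prescribed. Clearing denominators turns the weights into multiplicities of models in a finite family
(`exists_frequencyValuation_not_holds`). A machine that selects a member uniformly by rejection
sampling and then runs it has exactly these frequencies as probabilities
(`exists_probModel_prob_eq`). -/

namespace ProbSim

/-! ### Propositional compactness -/

namespace Fml

theorem isClopen_setOf_holds {A : Type} (φ : Fml A) :
    IsClopen {v : A → Bool | φ.Holds fun a => v a = true} := by
  induction φ with
  | atom a => exact (isClopen_discrete {true}).preimage (continuous_apply a)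
  | top => simpa [Holds] using isClopen_univ
  | neg φ ih => exact ih.compl
  | and φ ψ ih ih' => exact ih.inter ih'
  | or φ ψ ih ih' => exact ih.union ih'

/-- A formula outside a set that contains the tautologies and is closed under modus ponens is
refuted by a valuation in which the set is true. -/
theorem exists_valuation_of_not_mem {A : Type} {S : Set (Fml A)}
    (taut : ∀ φ : Fml A, φ.Tautology → φ ∈ S) (mp : ∀ φ ψ : Fml A, φ.imp ψ ∈ S → φ ∈ S → ψ ∈ S)
    {φ : Fml A} (h : φ ∉ S) : ∃ v : A → Prop, (∀ ψ ∈ S, ψ.Holds v) ∧ ¬ φ.Holds v := by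
  -- Finitely many premises are discharged one at a time by passing to implications.
  have consequence : ∀ l : List (Fml A), ∀ φ : Fml A, (∀ ψ ∈ l, ψ ∈ S) →
      (∀ v, (∀ ψ ∈ l, Holds v ψ) → Holds v φ) → φ ∈ S := by
    intro l
    induction l with
    | nil => intro φ _ h; exact taut φ fun v => h v (by simp)
    | cons ψ l ih =>
      intro φ hl h
      refine mp ψ φ (ih (ψ.imp φ) (fun χ hχ => hl χ (by simp [hχ])) fun v hv => ?_) (hl ψ (by simp))
      by_cases hψ : Holds v ψ
      · exact Or.inr (h v (by simpa [hψ] using hv))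
      · exact Or.inl hψ
  by_contra! hcon
  have hempty : ({v : A → Bool | ¬ φ.Holds fun a => v a = true} ∩
      ⋂ ψ : S, {v : A → Bool | ψ.1.Holds fun a => v a = true}) = ∅ := by
    ext v
    simp only [Set.mem_inter_iff, Set.mem_iInter, Set.mem_ofPred_eq, Set.mem_empty_iff_false,
      iff_false, not_and]
    intro hφ hS
    exact hφ (hcon _ fun ψ hψ => hS ⟨ψ, hψ⟩)
  obtain ⟨u, hu⟩ := IsCompact.elim_finite_subfamily_closed
    (φ.isClopen_setOf_holds.compl.1.isCompact) _ (fun ψ => ψ.1.isClopen_setOf_holds.1) hempty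
  refine h (consequence (u.toList.map (↑)) φ (fun ψ hψ => ?_) fun v hv => ?_)
  · obtain ⟨χ, _, rfl⟩ := List.mem_map.1 hψ
    exact χ.2
  by_contra hφ
  classical
  have hmem : (fun a => decide (v a)) ∈ ({v : A → Bool | ¬ φ.Holds fun a => v a = true} ∩
      ⋂ ψ ∈ u, {v : A → Bool | ψ.1.Holds fun a => v a = true}) := by
    simp only [Set.mem_inter_iff, Set.mem_iInter, Set.mem_ofPred_eq, decide_eq_true_eq]
    exact ⟨hφ, fun ψ hψ => hv ψ.1 (by simpa using hψ)⟩
  exact (Set.eq_empty_iff_forall_notMem.1 hu) _ hmem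

end Fml

/-! ### Elimination of variables -/

/-- Finitely many values of a total, additively closed predicate on `ℤⁿ` are the signs of a
rational linear form. -/
theorem exists_linear_form_sign {n : ℕ} {N : (Fin n → ℤ) → Prop}
    (zero : N 0) (hadd : ∀ a b, N a → N b → N (a + b)) (total : ∀ a, N a ∨ N (-a))
    (S : Finset (Fin n → ℤ)) :
    ∃ x : Fin n → ℚ, ∀ a ∈ S, N a ↔ ∑ i, (a i : ℚ) * x i ≤ 0 := by
  induction n with
  | zero => exact ⟨0, fun a _ => by simpa [Subsingleton.elim a 0] using zero⟩
  | succ n ih =>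
    have nsmul : ∀ (k : ℕ) a, N a → N (k • a) := by
      intro k a ha
      induction k with
      | zero => simpa using zero
      | succ k ihk => rw [succ_nsmul]; exact hadd _ _ ihk ha
    have smul : ∀ (k : ℤ) a, 0 ≤ k → N a → N (k • a) := by
      intro k a hk ha
      lift k to ℕ using hk
      simpa using nsmul k a ha
    have of_smul : ∀ (k : ℤ) a, 0 < k → N (k • a) → N a := by
      intro k a hk h
      rcases total a with ha | ha
      · exact ha
      -- `k • a + (k - 1) • (-a) = a`.
      · have := hadd _ _ h (smul (k - 1) _ (by lia) ha)
        convert this using 1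
        rw [sub_smul, smul_neg]; simp
    -- the constraints are closed under negation
    let S₁ : Finset (Fin (n + 1) → ℤ) := S ∪ S.image (fun a => -a)
    have hSS : ∀ a ∈ S, a ∈ S₁ := fun a ha => by simp [S₁, ha]
    have hneg : ∀ a ∈ S₁, -a ∈ S₁ := by
      intro a ha
      simp only [S₁, Finset.mem_union, Finset.mem_image] at ha ⊢
      rcases ha with ha | ⟨b, hb, rfl⟩
      · exact Or.inr ⟨a, ha, rfl⟩
      · exact Or.inl (by simpa using hb)
    -- Fourier–Motzkin: the induction hypothesis is applied on the hyperplane where coordinate `0`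
    -- vanishes, to the constraints lying there and to the pairwise combinations that cancel
    -- coordinate `0`. The other tails do no harm.
    obtain ⟨x, hx⟩ := ih (N := fun b => N (Fin.cons 0 b))
      (by convert zero using 1; ext i; refine Fin.cases ?_ (fun i => ?_) i <;> simp)
      (fun a b ha hb => by
        convert hadd _ _ ha hb using 1; ext i; refine Fin.cases ?_ (fun i => ?_) i <;> simp)
      (fun a => by
        convert total (Fin.cons 0 a) using 2; ext i; refine Fin.cases ?_ (fun i => ?_) i <;> simp)
      (S₁.image Fin.tail ∪
        (S₁ ×ˢ S₁).image fun p => Fin.tail (p.2 0 • p.1 - p.1 0 • p.2))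
    let l : (Fin (n + 1) → ℤ) → ℚ := fun a => ∑ i, (a i.succ : ℚ) * x i
    have hl_neg : ∀ a, l (-a) = - l a := fun a => by simp [l]
    have cons_tail : ∀ a : Fin (n + 1) → ℤ, a 0 = 0 →
        (Fin.cons 0 (Fin.tail a) : Fin (n + 1) → ℤ) = a := by
      intro a ha; rw [← ha]; exact Fin.cons_self_tail a
    have hflat : ∀ a ∈ S₁, a 0 = 0 → (N a ↔ l a ≤ 0) := by
      intro a ha h0
      have := hx (Fin.tail a) (Finset.mem_union_left _ (Finset.mem_image_of_mem _ ha))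
      rwa [cons_tail a h0] at this
    have hpair : ∀ a ∈ S₁, ∀ b ∈ S₁,
        (N (b 0 • a - a 0 • b) ↔ (b 0 : ℚ) * l a - a 0 * l b ≤ 0) := by
      intro a ha b hb
      have := hx (Fin.tail (b 0 • a - a 0 • b)) (Finset.mem_union_right _
        (Finset.mem_image.2 ⟨(a, b), Finset.mem_product.2 ⟨ha, hb⟩, rfl⟩))
      rw [cons_tail _ (by simp [mul_comm])] at this
      rw [this]
      have e : ∑ i, ((Fin.tail (b 0 • a - a 0 • b) i : ℤ) : ℚ) * x i
          = (b 0 : ℚ) * l a - a 0 * l b := by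
        simp only [l, Finset.mul_sum, ← Finset.sum_sub_distrib]
        refine Finset.sum_congr rfl fun i _ => ?_
        simp [Fin.tail]; ring
      rw [e]
    suffices H : ∃ x₀ : ℚ, ∀ a ∈ S₁, a 0 ≠ 0 → (N a ↔ (a 0 : ℚ) * x₀ + l a ≤ 0) by
      obtain ⟨x₀, hx₀⟩ := H
      refine ⟨Fin.cons x₀ x, fun a ha => ?_⟩
      rw [Fin.sum_univ_succ]
      simp only [Fin.cons_zero, Fin.cons_succ]
      by_cases h0 : a 0 = 0
      · rw [hflat a (hSS a ha) h0, h0]; simp [l]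
      · exact hx₀ a (hSS a ha) h0
    -- A null constraint with positive leading coefficient forces `x₀` to be its root, and any other
    -- constraint can be reduced modulo it. Without one, every constraint that involves `x₀` is to
    -- hold or fail strictly.
    by_cases hex : ∃ b ∈ S₁, 0 < b 0 ∧ N b ∧ N (-b)
    · obtain ⟨b, hb, hb0, hN, hN'⟩ := hex
      have hbq : (0 : ℚ) < b 0 := by exact_mod_cast hb0
      have hnull : ∀ k : ℤ, N (k • b) := by
        intro k
        rcases le_total 0 k with hk | hk
        · exact smul k b hk hN
        · simpa using smul (-k) (-b) (by lia) hN'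
      refine ⟨- l b / b 0, fun a ha _ => ?_⟩
      have h1 : N a ↔ N (b 0 • a - a 0 • b) := by
        constructor
        · intro h
          rw [sub_eq_add_neg, ← neg_smul]
          exact hadd _ _ (smul _ _ hb0.le h) (hnull _)
        · intro h
          refine of_smul (b 0) a hb0 ?_
          simpa using hadd _ _ h (hnull (a 0))
      rw [h1, hpair a ha b hb]
      have : (a 0 : ℚ) * (-l b / b 0) + l a = ((b 0 : ℚ) * l a - a 0 * l b) / b 0 := by
        field_simp; ring
      rw [this, div_le_iff₀ hbq, zero_mul]
    · push Not at hex
      classical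
      -- For a positive leading coefficient, `N a` asks for `x₀` below the root of `a` and `¬ N a`
      -- for `x₀` above it. The combined constraints put all lower bounds strictly below all upper
      -- bounds, and `ℚ` is dense.
      obtain ⟨x₀, hlo, hhi⟩ := Order.exists_between_finsets
        ((S₁.filter fun a => 0 < a 0 ∧ ¬ N a).image fun a => - l a / a 0)
        ((S₁.filter fun a => 0 < a 0 ∧ N a).image fun a => - l a / a 0) (by
          intro y hy z hz
          obtain ⟨a, ha, rfl⟩ := Finset.mem_image.1 hy
          obtain ⟨b, hb, rfl⟩ := Finset.mem_image.1 hz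
          obtain ⟨ha, ha0, hNa⟩ := Finset.mem_filter.1 ha
          obtain ⟨hb, hb0, hNb⟩ := Finset.mem_filter.1 hb
          have hbq : (0 : ℚ) < b 0 := by exact_mod_cast hb0
          have haq : (0 : ℚ) < a 0 := by exact_mod_cast ha0
          have h : ¬ N (b 0 • a - a 0 • b) := fun h => hNa <| of_smul (b 0) a hb0 <| by
            simpa using hadd _ _ h (smul (a 0) b ha0.le hNb)
          rw [hpair a ha b hb] at h
          rw [div_lt_div_iff₀ haq hbq]
          linarith)
      have hstrict : ∀ a ∈ S₁, 0 < a 0 → (N a → (a 0 : ℚ) * x₀ + l a < 0) ∧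
          (¬ N a → 0 < (a 0 : ℚ) * x₀ + l a) := by
        intro a ha ha0
        have haq : (0 : ℚ) < a 0 := by exact_mod_cast ha0
        constructor
        · intro hN
          have := hhi _ (Finset.mem_image_of_mem _ (Finset.mem_filter.2 ⟨ha, ha0, hN⟩))
          rw [lt_div_iff₀ haq] at this
          linarith
        · intro hN
          have := hlo _ (Finset.mem_image_of_mem _ (Finset.mem_filter.2 ⟨ha, ha0, hN⟩))
          rw [div_lt_iff₀ haq] at this
          linarith
      refine ⟨x₀, fun a ha h0 => ?_⟩
      rcases lt_or_gt_of_ne h0 with hlt | hgt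
      · have hpos : 0 < (-a) 0 := by simpa using hlt
        obtain ⟨h1, h2⟩ := hstrict (-a) (hneg a ha) hpos
        have hval : (((-a) 0 : ℤ) : ℚ) * x₀ + l (-a) = -((a 0 : ℚ) * x₀ + l a) := by
          rw [hl_neg]; simp; ring
        rw [hval] at h1 h2
        have hiff : N a ↔ ¬ N (-a) :=
          ⟨fun h h' => hex (-a) (hneg a ha) hpos h' (by simpa using h),
            fun h => (total a).resolve_right h⟩
        rw [hiff]
        by_cases hN : N (-a)
        · have := h1 hN
          simp only [hN, not_true, false_iff, not_le]
          linarith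
        · have := h2 hN
          simp only [hN, not_false_eq_true, true_iff]
          linarith
      · obtain ⟨h1, h2⟩ := hstrict a ha hgt
        by_cases hN : N a
        · simpa [hN] using (h1 hN).le
        · simpa [hN] using h2 hN

/-! ### Valuations that respect the axioms -/

/-- The valuation `v` of the linear inequalities makes every derivable formula true. -/
def Respects (V : LNonProb → Prop) (v : LIneq → Prop) : Prop :=
  ∀ ψ : L, Derivable V ψ → ψ.Holds v

/-- The sum with all coefficients negated. -/
def negTerms (t : List (ℤ × LNonProb)) : List (ℤ × LNonProb) := t.map fun p => (-p.1, p.2)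

/-- The sum with all coefficients replaced by `0`. -/
def zeroTerms (t : List (ℤ × LNonProb)) : List (ℤ × LNonProb) := t.map fun p => (0, p.2)

/-- The total coefficients of the formulas in a sum. -/
noncomputable def coeff (t : List (ℤ × LNonProb)) : LNonProb →₀ ℤ :=
  (t.map fun p => Finsupp.single p.2 p.1).sum

theorem coeff_append (t s : List (ℤ × LNonProb)) : coeff (t ++ s) = coeff t + coeff s := by
  simp [coeff]

theorem coeff_cons (p : ℤ × LNonProb) (t : List (ℤ × LNonProb)) :
    coeff (p :: t) = Finsupp.single p.2 p.1 + coeff t := by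
  simp [coeff]

theorem coeff_negTerms (t : List (ℤ × LNonProb)) : coeff (negTerms t) = - coeff t := by
  induction t with
  | nil => simp [coeff, negTerms]
  | cons p t ih =>
    have : negTerms (p :: t) = (-p.1, p.2) :: negTerms t := rfl
    rw [this, coeff_cons, coeff_cons, ih, Finsupp.single_neg]; abel

theorem coeff_perm {t s : List (ℤ × LNonProb)} (h : t.Perm s) : coeff t = coeff s :=
  (h.map _).sum_eq

namespace Respects

variable {V : LNonProb → Prop} {v : LIneq → Prop}

theorem perm (h : Respects V v) {t t' : List (ℤ × LNonProb)} (ht : t.Perm t') {c : ℤ}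
    (hc : v ⟨t, c⟩) :
    v ⟨t', c⟩ := by
  have := h _ (.permutation t t' c ht)
  simp only [Fml.iff, Fml.imp, Fml.Holds, le] at this
  tauto

theorem append_zeroTerms_iff (h : Respects V v) (t s : List (ℤ × LNonProb)) (c : ℤ) :
    v ⟨t ++ zeroTerms s, c⟩ ↔ v ⟨t, c⟩ := by
  induction s generalizing t with
  | nil => simp [zeroTerms]
  | cons p s ih =>
    have e : t ++ zeroTerms (p :: s) = (t ++ [(0, p.2)]) ++ zeroTerms s := by simp [zeroTerms]
    have := h _ (.zero t p.2 c)
    simp only [Fml.iff, Fml.imp, Fml.Holds, le] at this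
    rw [e, ih]
    tauto

theorem addIneq (h : Respects V v) (t : List (ℤ × ℤ × LNonProb)) {c c' : ℤ}
    (h₁ : v ⟨t.map fun p => (p.1, p.2.2), c⟩) (h₂ : v ⟨t.map fun p => (p.2.1, p.2.2), c'⟩) :
    v ⟨t.map fun p => (p.1 + p.2.1, p.2.2), c + c'⟩ := by
  have := h _ (.addIneq t c c')
  simp only [Fml.imp, Fml.Holds, le] at this
  tauto

/-- AddIneq only adds sums over one common list of formulas, so both sums are first padded with zero
terms to the list of `t ++ s`. -/
theorem append (h : Respects V v) {t s : List (ℤ × LNonProb)} {c d : ℤ} (ht : v ⟨t, c⟩)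
    (hs : v ⟨s, d⟩) :
    v ⟨t ++ s, c + d⟩ := by
  have key := h.addIneq (t.map (fun p => (p.1, 0, p.2)) ++ s.map fun p => (0, p.1, p.2))
    (c := c) (c' := d)
  simp only [List.map_append, List.map_map, Function.comp_def, add_zero, zero_add, Prod.mk.eta,
    List.map_id'] at key
  exact key ((h.append_zeroTerms_iff t s c).2 ht)
    (h.perm List.perm_append_comm ((h.append_zeroTerms_iff s t d).2 hs))

theorem total (h : Respects V v) (t : List (ℤ × LNonProb)) (c : ℤ) :
    v ⟨t, c⟩ ∨ v ⟨negTerms t, -c⟩ :=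
  h _ (.dichotomy t c)

theorem not_of_lt (h : Respects V v) {t : List (ℤ × LNonProb)} {b c : ℤ} (hcb : c < b)
    (ht : v ⟨t, c⟩) :
    ¬ v ⟨negTerms t, -b⟩ := by
  have := h _ (.mono t b c hcb)
  simp only [Fml.imp, Fml.Holds, le, lt, ge] at this
  exact this.resolve_left (not_not.2 ht)

theorem mult (h : Respects V v) {t : List (ℤ × LNonProb)} {b c : ℤ} (hb : 0 < b) (ht : v ⟨t, c⟩) :
    v ⟨t.map fun p => (b * p.1, p.2), b * c⟩ := by
  have := h _ (.mult t b c hb)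
  simp only [Fml.imp, Fml.Holds, le] at this
  tauto

theorem nil (h : Respects V v) : v ⟨[], 0⟩ := by simpa [negTerms] using h.total [] 0

/-- Dist for `φ` and itself gives both signs of the case `a = 1`, which Mult scales. Mult needs a
positive factor, so `a = 0` comes from Zero. -/
theorem pair (h : Respects V v) (hV : ∀ φ : LNonProb, V (φ.iff φ)) (a : ℤ) (φ : LNonProb) :
    v ⟨[(-a, φ), (a, φ)], 0⟩ := by
  have hd := h _ (.dist φ φ (hV φ))
  simp only [eq, Fml.Holds, le, ge, List.map_cons, List.map_nil, neg_neg, neg_zero] at hd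
  rcases lt_trichotomy a 0 with ha | rfl | ha
  · simpa using h.mult (b := -a) (by lia) hd.1
  · simpa [zeroTerms] using (h.append_zeroTerms_iff [] [(0, φ), (0, φ)] 0).2 h.nil
  · simpa using h.mult ha hd.2

theorem negTerms_append_self (h : Respects V v) (hV : ∀ φ : LNonProb, V (φ.iff φ))
    (s : List (ℤ × LNonProb)) :
    v ⟨negTerms s ++ s, 0⟩ := by
  induction s with
  | nil => exact h.nil
  | cons p s ih =>
    refine h.perm ?_ (h.append (h.pair hV p.1 p.2) ih)
    simp only [negTerms, List.map_cons, List.cons_append, List.nil_append]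
    exact List.Perm.cons _ List.perm_middle.symm

/-- Adding the valid inequality `-s + s ≤ 0` termwise makes every coefficient beyond `t` zero, and
Zero removes those terms. -/
theorem of_append_neg (h : Respects V v) (hV : ∀ φ : LNonProb, V (φ.iff φ))
    {t s : List (ℤ × LNonProb)} {c : ℤ}
    (ht : v ⟨t ++ (s ++ negTerms s), c⟩) : v ⟨t, c⟩ := by
  have hs : v ⟨zeroTerms t ++ (negTerms s ++ s), 0⟩ :=
    h.perm List.perm_append_comm
      ((h.append_zeroTerms_iff _ t 0).2 (h.negTerms_append_self hV s))
  have key := h.addIneq (t.map (fun p => (p.1, 0, p.2)) ++ (s.map (fun p => (p.1, -p.1, p.2)) ++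
    s.map fun p => (-p.1, p.1, p.2))) (c := c) (c' := 0)
  simp only [List.map_append, List.map_map, Function.comp_def, add_zero, Prod.mk.eta,
    List.map_id', add_neg_cancel, neg_add_cancel] at key
  have := key ht hs
  have e : t ++ ((s.map fun p => ((0 : ℤ), p.2)) ++ s.map fun p => ((0 : ℤ), p.2))
      = t ++ zeroTerms (s ++ s) := by simp [zeroTerms]
  rw [e] at this
  exact (h.append_zeroTerms_iff t _ c).1 this

/-- No axiom merges repeated occurrences of a formula; this supplies the merging. -/
theorem const_formula (h : Respects V v) (hV : ∀ φ : LNonProb, V (φ.iff φ)) (φ : LNonProb)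
    (l : List ℤ) :
    v ⟨(l.map fun a => (a, φ)) ++ [(-l.sum, φ)], 0⟩ := by
  induction l with
  | nil => simpa [zeroTerms] using (h.append_zeroTerms_iff [] [(0, φ)] 0).2 h.nil
  | cons a l ih =>
    -- Two cancelling pairs are spread over three slots, sharing the last, and added there.
    have h3 : v ⟨[(a, φ), (l.sum, φ), (-a + -l.sum, φ)], 0⟩ := by
      have h1 := (h.append_zeroTerms_iff _ [(0, φ)] 0).2 (h.pair hV a φ)
      have h2 := (h.append_zeroTerms_iff _ [(0, φ)] 0).2 (h.pair hV l.sum φ)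
      simpa using h.addIneq [(a, 0, φ), (0, l.sum, φ), (-a, -l.sum, φ)]
        (c := 0) (c' := 0)
        (h.perm ((List.Perm.swap _ _ _).trans ((List.Perm.swap _ _ _).cons _)) h1)
        (h.perm (List.perm_append_comm.trans ((List.Perm.swap _ _ _).cons _)) h2)
    refine h.of_append_neg hV (s := [(l.sum, φ)]) (h.perm ?_ (h.append h3 ih))
    simp only [negTerms, List.map_cons, List.map_nil, List.sum_cons, neg_add, List.cons_append,
      List.nil_append, List.append_assoc]
    refine List.Perm.cons _ ?_
    classical
    rw [List.perm_iff_count]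
    intro p
    simp only [List.count_append, List.count_cons, List.count_nil]
    lia

/-- Induction on length: the terms with the same formula as the first have coefficients summing to
zero, so they can be split off by `const_formula`. -/
theorem of_coeff_eq_zero (h : Respects V v) (hV : ∀ φ : LNonProb, V (φ.iff φ))
    (t : List (ℤ × LNonProb)) (ht : coeff t = 0) :
    v ⟨t, 0⟩ := by
  classical
  induction hn : t.length using Nat.strong_induction_on generalizing t with
  | _ n ih =>
  match t with
  | [] => exact h.nil
  | (a, φ) :: t =>
    set d := (a, φ) :: t with hd
    have hperm := List.filter_append_perm (fun p : ℤ × LNonProb => decide (p.2 = φ)) d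
    set d₁ := d.filter fun p : ℤ × LNonProb => decide (p.2 = φ) with hd₁
    set d₂ := d.filter fun p : ℤ × LNonProb => !decide (p.2 = φ) with hd₂
    have hsame : d₁ = (d₁.map Prod.fst).map fun a => (a, φ) := by
      rw [List.map_map]
      conv_lhs => rw [← List.map_id d₁]
      refine List.map_congr_left fun p hp => ?_
      have : p.2 = φ := by simpa using (List.mem_filter.1 hp).2
      simp [← this]
    have hc₁ : ∀ l : List ℤ, coeff (l.map fun a => (a, φ)) = Finsupp.single φ l.sum := by
      intro l
      induction l with
      | nil => simp [coeff]
      | cons a l ih => rw [List.map_cons, coeff_cons, ih]; simp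
    have hc₂ : ∀ l : List (ℤ × LNonProb), (∀ p ∈ l, p.2 ≠ φ) → coeff l φ = 0 := by
      intro l
      induction l with
      | nil => intro _; simp [coeff]
      | cons p l ih =>
        intro hl
        rw [coeff_cons, Finsupp.add_apply, ih fun q hq => hl q (by simp [hq])]
        simp [hl p (by simp)]
    have hsum : coeff d₁ + coeff d₂ = 0 := by rw [← coeff_append, coeff_perm hperm, ht]
    rw [hsame, hc₁] at hsum
    have hs : (d₁.map Prod.fst).sum = 0 := by
      have := DFunLike.congr_fun hsum φ
      rw [Finsupp.add_apply, hc₂ d₂ fun p hp => by simpa using (List.mem_filter.1 hp).2] at this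
      simpa using this
    have h₁ : v ⟨d₁, 0⟩ := by
      have := h.const_formula hV φ (d₁.map Prod.fst)
      rw [← hsame, hs] at this
      exact (h.append_zeroTerms_iff d₁ [(0, φ)] 0).1 this
    have h₂ : v ⟨d₂, 0⟩ := by
      refine ih d₂.length ?_ d₂ (by simpa [hs] using hsum) rfl
      rw [← hn]
      refine List.length_filter_lt_length_iff_exists.2 ⟨(a, φ), by simp [hd], by simp⟩
    exact h.perm hperm (h.append h₁ h₂)

/-- This lets `v` descend from lists of terms to the free abelian group on formulas. -/
theorem of_coeff_eq (h : Respects V v) (hV : ∀ φ : LNonProb, V (φ.iff φ))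
    {t s : List (ℤ × LNonProb)} {c : ℤ}
    (hts : coeff t = coeff s) (ht : v ⟨t, c⟩) : v ⟨s, c⟩ := by
  have h0 : v ⟨negTerms t ++ s, 0⟩ :=
    h.of_coeff_eq_zero hV _ (by rw [coeff_append, coeff_negTerms, hts]; simp)
  refine h.of_append_neg hV (s := t) (h.perm ?_ (by simpa using h.append ht h0))
  rw [← List.append_assoc]
  exact List.perm_append_comm

end Respects

/-! ### The ordered group of formal sums -/

/-- The formal sum `f` of probabilities is at most `0` according to `v`. -/
def Nonpos (v : LIneq → Prop) (f : LNonProb →₀ ℤ) : Prop := ∃ t, coeff t = f ∧ v ⟨t, 0⟩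

/-- The formal sums `f` and `g` have the same value according to `v`. -/
def Equal (v : LIneq → Prop) (f g : LNonProb →₀ ℤ) : Prop :=
  Nonpos v (f - g) ∧ Nonpos v (g - f)

/-- Truth in all valuations of a class. -/
def TrueIn (C : Set (LCond → Prop)) (φ : LNonProb) : Prop := ∀ w ∈ C, φ.Holds w

theorem TrueIn.iff_refl (C : Set (LCond → Prop)) (φ : LNonProb) : TrueIn C (φ.iff φ) := by
  intro w _
  simp only [Fml.iff, Fml.imp, Fml.Holds]
  tauto

namespace Respects

variable {C : Set (LCond → Prop)} {v : LIneq → Prop}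

theorem nonpos_add (h : Respects (TrueIn C) v) {f g : LNonProb →₀ ℤ} (hf : Nonpos v f)
    (hg : Nonpos v g) :
    Nonpos v (f + g) := by
  obtain ⟨t, rfl, ht⟩ := hf
  obtain ⟨s, rfl, hs⟩ := hg
  exact ⟨t ++ s, coeff_append t s, h.append ht hs⟩

theorem nonpos_zero (h : Respects (TrueIn C) v) : Nonpos v 0 := ⟨[], rfl, h.nil⟩

theorem nonpos_total (h : Respects (TrueIn C) v) (f : LNonProb →₀ ℤ) : Nonpos v f ∨ Nonpos v
    (-f) := by
  obtain ⟨t, rfl⟩ : ∃ t, coeff t = f := by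
    induction f using Finsupp.induction_linear with
    | zero => exact ⟨[], rfl⟩
    | add f g hf hg =>
      obtain ⟨t, rfl⟩ := hf
      obtain ⟨s, rfl⟩ := hg
      exact ⟨t ++ s, coeff_append t s⟩
    | single φ a => exact ⟨[(a, φ)], by simp [coeff]⟩
  rcases h.total t 0 with ht | ht
  · exact Or.inl ⟨t, rfl, ht⟩
  · exact Or.inr ⟨negTerms t, coeff_negTerms t, by simpa using ht⟩

theorem nonpos_coeff_iff (h : Respects (TrueIn C) v) (t : List (ℤ × LNonProb)) : Nonpos v
    (coeff t) ↔ v ⟨t, 0⟩ :=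
  ⟨fun ⟨_, hs, hv⟩ => h.of_coeff_eq (TrueIn.iff_refl C) hs hv, fun ht => ⟨t, rfl, ht⟩⟩

theorem equal_refl (h : Respects (TrueIn C) v) (f : LNonProb →₀ ℤ) : Equal v f f := by
  simp [Equal, h.nonpos_zero]

theorem equal_symm {f g : LNonProb →₀ ℤ} (hfg : Equal v f g) : Equal v g f := hfg.symm

theorem equal_trans (h : Respects (TrueIn C) v) {f g k : LNonProb →₀ ℤ} (h₁ : Equal v f g)
    (h₂ : Equal v g k) :
    Equal v f k := by
  refine ⟨?_, ?_⟩
  · simpa using h.nonpos_add h₁.1 h₂.1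
  · simpa using h.nonpos_add h₂.2 h₁.2

theorem equal_add (h : Respects (TrueIn C) v) {f g f' g' : LNonProb →₀ ℤ} (h₁ : Equal v f g)
    (h₂ : Equal v f' g') :
    Equal v (f + f') (g + g') := by
  refine ⟨?_, ?_⟩
  · rw [add_sub_add_comm]; exact h.nonpos_add h₁.1 h₂.1
  · rw [add_sub_add_comm]; exact h.nonpos_add h₁.2 h₂.2

theorem equal_neg {f g : LNonProb →₀ ℤ} (h₁ : Equal v f g) : Equal v (-f) (-g) := by
  refine ⟨?_, ?_⟩
  · simpa [neg_add_eq_sub] using h₁.2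
  · simpa [neg_add_eq_sub] using h₁.1

theorem equal_zsmul (h : Respects (TrueIn C) v) (k : ℤ) {f g : LNonProb →₀ ℤ} (h₁ : Equal v f g) :
    Equal v (k • f) (k • g) := by
  induction k using Int.induction_on with
  | zero => simpa using h.equal_refl 0
  | succ n ih => rw [add_smul, add_smul, one_smul, one_smul]; exact h.equal_add ih h₁
  | pred n ih =>
    rw [sub_smul, sub_smul, one_smul, one_smul, sub_eq_add_neg, sub_eq_add_neg]
    exact h.equal_add ih (equal_neg h₁)

theorem equal_list_sum (h : Respects (TrueIn C) v) {ι : Type} (l : List ι) (f g : ι → LNonProb →₀ ℤ)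
    (hfg : ∀ i ∈ l, Equal v (f i) (g i)) : Equal v (l.map f).sum (l.map g).sum := by
  induction l with
  | nil => exact h.equal_refl 0
  | cons i l ih =>
    simp only [List.map_cons, List.sum_cons]
    exact h.equal_add (hfg i (by simp)) (ih fun j hj => hfg j (by simp [hj]))

theorem nonpos_congr (h : Respects (TrueIn C) v) {f g : LNonProb →₀ ℤ} (h₁ : Equal v f g) :
    Nonpos v f ↔ Nonpos v g :=
  ⟨fun hf => by simpa using h.nonpos_add h₁.2 hf, fun hg => by simpa using h.nonpos_add h₁.1 hg⟩

theorem equal_of_eq {t : List (ℤ × LNonProb)} (ht : (eq t 0).Holds v) : Equal v (coeff t) 0 := by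
  simp only [eq, le, ge, Fml.Holds, neg_zero] at ht
  exact ⟨⟨t, by simp, ht.1⟩, ⟨negTerms t, by simp [coeff_negTerms], ht.2⟩⟩

theorem equal_of_trueIn (h : Respects (TrueIn C) v) {φ ψ : LNonProb}
    (hφψ : ∀ w ∈ C, (φ.Holds w ↔ ψ.Holds w)) :
    Equal v (Finsupp.single φ 1) (Finsupp.single ψ 1) := by
  have hV : TrueIn C (φ.iff ψ) := by
    intro w hw
    have := hφψ w hw
    simp only [Fml.iff, Fml.imp, Fml.Holds]
    tauto
  have := equal_of_eq (h _ (.dist φ ψ hV))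
  have := h.equal_add this (h.equal_refl (Finsupp.single ψ 1))
  simpa [coeff, add_assoc] using this

theorem equal_and_add_and_not (h : Respects (TrueIn C) v) (φ ψ : LNonProb) :
    Equal v (Finsupp.single φ 1)
      (Finsupp.single (φ.and ψ) 1 + Finsupp.single (φ.and ψ.neg) 1) := by
  have := equal_of_eq (h _ (.add φ ψ))
  have := h.equal_add this (h.equal_refl (Finsupp.single φ 1))
  refine equal_symm ?_
  simpa [coeff, add_assoc] using this

/-- If `φ` is never true, then `φ ∧ φ` and `φ ∧ ¬ φ` are both equivalent to `φ`, so Add and Dist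
give `P(φ) = P(φ) + P(φ)`. -/
theorem equal_zero_of_unsatisfiable (h : Respects (TrueIn C) v) {φ : LNonProb}
    (hφ : ∀ w ∈ C, ¬ φ.Holds w) :
    Equal v (Finsupp.single φ 1) 0 := by
  have h₁ := h.equal_and_add_and_not φ φ
  have h₂ := h.equal_trans h₁ (h.equal_add
    (h.equal_of_trueIn (ψ := φ) fun w hw => by simp [Fml.Holds])
    (h.equal_of_trueIn (ψ := φ) fun w hw => by simp [Fml.Holds, hφ w hw]))
  have h₃ := h.equal_add h₂ (h.equal_refl (-Finsupp.single φ 1))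
  refine equal_symm ?_
  simpa [add_assoc] using h₃

theorem nonpos_neg_single (h : Respects (TrueIn C) v) (φ : LNonProb) : Nonpos v
    (-Finsupp.single φ 1) :=
  ⟨[(-1, φ)], by simp [coeff, Finsupp.single_neg], by
    simpa [ge, le, Fml.Holds] using h _ (.nonNeg φ)⟩

theorem top_le (h : Respects (TrueIn C) v) (c : ℤ) : v ⟨[(c, .top)], c⟩ := by
  have hn := h _ .norm
  simp only [eq, Fml.Holds, le, ge, List.map_cons, List.map_nil] at hn
  rcases lt_trichotomy c 0 with hc | rfl | hc
  · simpa using h.mult (b := -c) (by lia) hn.2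
  · simpa [zeroTerms] using (h.append_zeroTerms_iff [] [(0, .top)] 0).2 h.nil
  · simpa using h.mult hc hn.1

/-- Norm gives `P(⊤) ≥ 1`, which Mono makes incompatible with `P(⊤) ≤ 0`. -/
theorem not_nonpos_top (h : Respects (TrueIn C) v) : ¬ Nonpos v (Finsupp.single .top 1) := by
  intro hn
  have e : Finsupp.single .top 1 = coeff [(1, .top)] := by simp [coeff]
  rw [e, h.nonpos_coeff_iff] at hn
  exact h.not_of_lt zero_lt_one hn (h.top_le (-1))

/-- Homogenization: by Norm, the constant `c` may be replaced by `c P(⊤)`. -/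
theorem iff_nonpos (h : Respects (TrueIn C) v) (t : List (ℤ × LNonProb)) (c : ℤ) :
    v ⟨t, c⟩ ↔ Nonpos v (coeff t - c • Finsupp.single .top 1) := by
  have e : coeff t - c • Finsupp.single .top 1 = coeff (t ++ [(-c, .top)]) := by
    rw [coeff_append]; simp [coeff, sub_eq_add_neg, Finsupp.single_neg]
  rw [e, h.nonpos_coeff_iff]
  constructor
  · intro ht
    simpa using h.append ht (h.top_le (-c))
  · intro ht
    refine h.of_append_neg (TrueIn.iff_refl C) (s := [(-c, .top)]) ?_
    simpa [negTerms] using h.append ht (h.top_le c)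

end Respects

/-! ### State descriptions and mixtures -/

namespace Fml

/-- The atoms that occur in a formula. -/
def atoms {A : Type} : Fml A → List A
  | atom a => [a]
  | top => []
  | neg φ => φ.atoms
  | and φ ψ => φ.atoms ++ ψ.atoms
  | or φ ψ => φ.atoms ++ ψ.atoms

theorem holds_congr {A : Type} {v w : A → Prop} (φ : Fml A)
    (h : ∀ a ∈ φ.atoms, (v a ↔ w a)) : φ.Holds v ↔ φ.Holds w := by
  induction φ with
  | atom a => exact h a (by simp [atoms])
  | top => rfl
  | neg φ ih => exact not_congr (ih h)
  | and φ ψ ih ih' =>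
    exact and_congr (ih fun a ha => h a (by simp [atoms, ha]))
      (ih' fun a ha => h a (by simp [atoms, ha]))
  | or φ ψ ih ih' =>
    exact or_congr (ih fun a ha => h a (by simp [atoms, ha]))
      (ih' fun a ha => h a (by simp [atoms, ha]))

/-- The conjunctions that decide each of the given atoms. -/
def stateDescriptions {A : Type} : List A → List (Fml A)
  | [] => [top]
  | a :: l => (stateDescriptions l).map (fun δ => δ.and (atom a)) ++
      (stateDescriptions l).map fun δ => δ.and (neg (atom a))

theorem agree_of_mem_stateDescriptions {A : Type} {v w : A → Prop} {l : List A} {δ : Fml A}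
    (hδ : δ ∈ stateDescriptions l) (hv : δ.Holds v) (hw : δ.Holds w) :
    ∀ a ∈ l, (v a ↔ w a) := by
  induction l generalizing δ with
  | nil => simp
  | cons b l ih =>
    simp only [stateDescriptions, List.mem_append, List.mem_map] at hδ
    rcases hδ with ⟨δ, hδ, rfl⟩ | ⟨δ, hδ, rfl⟩ <;>
    · simp only [Holds] at hv hw
      have := ih hδ hv.1 hw.1
      simp only [List.mem_cons, forall_eq_or_imp]
      exact ⟨by tauto, this⟩

end Fml

open Classical in
/-- `1` if the conjunction of `δ` and `χ` is true in some valuation in `C`, and `0` otherwise. -/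
noncomputable def satIndicator (C : Set (LCond → Prop)) (δ χ : LNonProb) : ℤ :=
  if ∃ w ∈ C, δ.Holds w ∧ χ.Holds w then 1 else 0

namespace Respects

variable {C : Set (LCond → Prop)} {v : LIneq → Prop}

theorem equal_sum_stateDescriptions_and (h : Respects (TrueIn C) v) (l : List LCond)
    (χ : LNonProb) :
    Equal v (Finsupp.single χ 1)
      ((Fml.stateDescriptions l).map fun δ => Finsupp.single (δ.and χ) 1).sum := by
  induction l with
  | nil =>
    simpa [Fml.stateDescriptions] using
      h.equal_of_trueIn (φ := χ) (ψ := Fml.top.and χ) fun w _ => by simp [Fml.Holds]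
  | cons a l ih =>
    refine h.equal_trans ih ?_
    simp only [Fml.stateDescriptions, List.map_append, List.map_map, Function.comp_def,
      List.sum_append, ← List.sum_map_add]
    refine h.equal_list_sum _ _ _ fun δ _ =>
      h.equal_trans (h.equal_and_add_and_not (δ.and χ) (.atom a)) (h.equal_add ?_ ?_) <;>
    · refine h.equal_of_trueIn fun w _ => ?_
      simp only [Fml.Holds]
      tauto

/-- A state description decides `χ`: either `δ ∧ χ` is equivalent to `δ` over `C`, or it is
unsatisfiable there and has probability zero. -/
theorem equal_sum_stateDescriptions (h : Respects (TrueIn C) v) {l : List LCond} {χ : LNonProb}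
    (hχ : ∀ a ∈ χ.atoms, a ∈ l) :
    Equal v (Finsupp.single χ 1)
      ((Fml.stateDescriptions l).map fun δ => satIndicator C δ χ • Finsupp.single δ 1).sum := by
  refine h.equal_trans (h.equal_sum_stateDescriptions_and l χ)
    (h.equal_list_sum _ _ _ fun δ hδ => ?_)
  unfold satIndicator
  split_ifs with hsat
  · obtain ⟨w, _, hδw, hχw⟩ := hsat
    rw [one_smul]
    refine h.equal_of_trueIn fun w' _ => ?_
    simp only [Fml.Holds, and_iff_left_iff_imp]
    intro hδw'
    exact (χ.holds_congr fun a ha =>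
      Fml.agree_of_mem_stateDescriptions hδ hδw hδw' a (hχ a ha)).1 hχw
  · rw [zero_smul]
    exact h.equal_zero_of_unsatisfiable fun w hw hδχ => hsat ⟨w, hw, hδχ⟩

end Respects

theorem exists_nat_multiple {n : ℕ} (x : Fin n → ℚ) (hx : ∀ i, 0 ≤ x i) :
    ∃ K : ℕ, 0 < K ∧ ∃ y : Fin n → ℕ, ∀ i, (K : ℚ) * x i = y i := by
  refine ⟨∏ i, (x i).den, Finset.prod_pos fun i _ => (x i).den_pos,
    fun i => (∏ j ∈ Finset.univ.erase i, (x j).den) * (x i).num.toNat, fun i => ?_⟩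
  rw [← Finset.prod_erase_mul _ _ (Finset.mem_univ i)]
  push_cast
  rw [mul_assoc, Rat.den_mul_eq_num]
  congr 1
  have := Int.toNat_of_nonneg (Rat.num_nonneg.2 (hx i))
  exact_mod_cast this.symm

/-- The truth value of a linear inequality when the probability of a formula is its frequency
in a finite family of valuations. -/
def frequencyValuation {ι : Type} [Fintype ι] (w : ι → LCond → Prop) (e : LIneq) : Prop :=
  (e.terms.map fun p => (p.1 : ℝ) *
    ((Nat.card {j // p.2.Holds (w j)} : ℝ) / Fintype.card ι)).sum ≤ (e.bound : ℝ)

/-- A formula that is not derivable fails in a uniform mixture of finitely many admissible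
valuations. -/
theorem exists_frequencyValuation_not_holds {C : Set (LCond → Prop)} {φ : L}
    (hφ : ¬ Derivable (TrueIn C) φ) :
    ∃ (ι : Type) (_ : Fintype ι) (_ : Nonempty ι) (w : ι → LCond → Prop), (∀ j, w j ∈ C) ∧
      ¬ φ.Holds (frequencyValuation w) := by
  classical
  obtain ⟨v, hv, hφv⟩ := Fml.exists_valuation_of_not_mem (S := {ψ | Derivable (TrueIn C) ψ})
    (fun ψ hψ => .taut ψ hψ) (fun ψ χ h₁ h₂ => .mp ψ χ h₁ h₂) hφ
  have h : Respects (TrueIn C) v := hv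
  let l : List LCond := φ.atoms.flatMap fun e => e.terms.flatMap fun p => p.2.atoms
  have hl : ∀ e ∈ φ.atoms, ∀ p ∈ e.terms, ∀ a ∈ p.2.atoms, a ∈ l := by
    intro e he p hp a ha
    simp only [l, List.mem_flatMap]
    exact ⟨e, he, p, hp, ha⟩
  let n := (Fml.stateDescriptions l).length
  let δ : Fin n → LNonProb := fun i => (Fml.stateDescriptions l)[i]
  have hδ : ∀ i, δ i ∈ Fml.stateDescriptions l := fun i => List.getElem_mem _
  let Φ := Fintype.linearCombination ℤ fun i => (Finsupp.single (δ i) 1 : LNonProb →₀ ℤ)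
  let m : LNonProb → Fin n → ℤ := fun χ i => satIndicator C (δ i) χ
  have hΦm : ∀ χ : LNonProb, (∀ a ∈ χ.atoms, a ∈ l) →
      Equal v (Finsupp.single χ 1) (Φ (m χ)) := by
    intro χ hχ
    have := h.equal_sum_stateDescriptions hχ
    rw [← Fin.sum_univ_fun_getElem] at this
    exact this
  let vec : LIneq → Fin n → ℤ := fun e =>
    (e.terms.map fun p => p.1 • m p.2).sum - e.bound • m .top
  have hvec : ∀ e ∈ φ.atoms, (v e ↔ Nonpos v (Φ (vec e))) := by
    intro e he
    rw [show v e ↔ v ⟨e.terms, e.bound⟩ from Iff.rfl, h.iff_nonpos]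
    refine h.nonpos_congr ?_
    simp only [vec, map_sub, map_smul, map_list_sum, List.map_map, Function.comp_def]
    rw [sub_eq_add_neg, sub_eq_add_neg]
    refine h.equal_add ?_ (Respects.equal_neg (h.equal_zsmul _ (hΦm _ (by simp [Fml.atoms]))))
    refine h.equal_list_sum _ _ _ fun p hp => ?_
    have := h.equal_zsmul p.1 (hΦm p.2 (hl e he p hp))
    rwa [Finsupp.smul_single, smul_eq_mul, mul_one] at this
  -- Besides the inequalities of `φ`, the prescribed signs include those of the negated unit
  -- vectors, which make the weights nonnegative, and that of `⊤`, which makes the total weight of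
  -- the satisfiable descriptions positive.
  obtain ⟨x, hx⟩ := exists_linear_form_sign (N := fun a => Nonpos v (Φ a))
    (by simpa using h.nonpos_zero)
    (fun a b ha hb => by rw [map_add]; exact h.nonpos_add ha hb)
    (fun a => by rw [map_neg]; exact h.nonpos_total _)
    ((φ.atoms.map vec).toFinset ∪ Finset.univ.image (fun i : Fin n => -Pi.single i 1) ∪ {m .top})
  have hx0 : ∀ i, 0 ≤ x i := by
    intro i
    have h₁ := hx (-Pi.single i 1) (by simp)
    have h₂ : Nonpos v (Φ (-Pi.single i 1)) := by
      rw [map_neg, Fintype.linearCombination_apply_single, one_smul]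
      exact h.nonpos_neg_single _
    have h₃ := h₁.1 h₂
    simpa [Pi.single_apply] using h₃
  obtain ⟨K, hK, y, hy⟩ := exists_nat_multiple x hx0
  let sat : Fin n → Prop := fun i => ∃ w ∈ C, (δ i).Holds w
  -- Unsatisfiable descriptions have no model to repeat. Dropping them changes no count, since `m χ
  -- i = 0` for them.
  let y' : Fin n → ℕ := fun i => if sat i then y i else 0
  let w : Fin n → LCond → Prop := fun i => if hi : sat i then hi.choose else fun _ => False
  have hw : ∀ i, sat i → w i ∈ C ∧ (δ i).Holds (w i) := by
    intro i hi
    simp only [w, hi, dif_pos]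
    exact hi.choose_spec
  let ev : (Fin n → ℤ) →+ ℝ :=
    { toFun := fun a => ∑ i, (a i : ℝ) * (K * x i : ℚ)
      map_zero' := by simp
      map_add' := fun a b => by simp [add_mul, Finset.sum_add_distrib] }
  have hev : ∀ a, ev a = ((K * ∑ i, (a i : ℚ) * x i : ℚ) : ℝ) := by
    intro a
    simp only [ev, AddMonoidHom.coe_mk, ZeroHom.coe_mk, Finset.mul_sum, Rat.cast_sum]
    refine Finset.sum_congr rfl fun i _ => ?_
    push_cast; ring
  have hev_nonpos : ∀ a, ev a ≤ 0 ↔ ∑ i, (a i : ℚ) * x i ≤ 0 := by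
    intro a
    rw [hev, Rat.cast_nonpos]
    have : (0 : ℚ) < K := by exact_mod_cast hK
    constructor
    · intro h; by_contra! hc; exact absurd (mul_pos this hc) (not_lt.2 h)
    · intro h; exact mul_nonpos_of_nonneg_of_nonpos this.le h
  have hcount : ∀ χ : LNonProb, (∀ a ∈ χ.atoms, a ∈ l) →
      (Nat.card {j : Σ i : Fin n, Fin (y' i) // χ.Holds (w j.1)} : ℝ) = ev (m χ) := by
    intro χ hχ
    rw [Nat.card_eq_fintype_card, Fintype.card_subtype, Finset.card_filter, Fintype.sum_sigma]
    simp only [ev, AddMonoidHom.coe_mk, ZeroHom.coe_mk, hy, Nat.cast_sum]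
    refine Finset.sum_congr rfl fun i _ => ?_
    by_cases hi : sat i
    · have hm : m χ i = if χ.Holds (w i) then 1 else 0 := by
        simp only [m, satIndicator]
        congr 1
        refine propext ⟨?_, fun hχw => ⟨w i, (hw i hi).1, (hw i hi).2, hχw⟩⟩
        rintro ⟨w', _, hδw', hχw'⟩
        exact (χ.holds_congr fun a ha => Fml.agree_of_mem_stateDescriptions (hδ i) hδw'
          (hw i hi).2 a (hχ a ha)).1 hχw'
      rw [hm]
      have hy' : y' i = y i := if_pos hi
      split_ifs <;> simp [hy']
    · have hm : m χ i = 0 := by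
        simp only [m, satIndicator]
        exact if_neg fun ⟨w', hw', hδw', _⟩ => hi ⟨w', hw', hδw'⟩
      rw [hm]
      simp [y', hi]
  have hcard : (Fintype.card (Σ i : Fin n, Fin (y' i)) : ℝ) = ev (m .top) := by
    rw [← hcount .top (by simp [Fml.atoms])]
    simp only [Fml.Holds]
    rw [Nat.card_congr (Equiv.subtypeUnivEquiv fun _ => trivial), Nat.card_eq_fintype_card]
  have hpos : 0 < ev (m .top) := by
    rw [← not_le, hev_nonpos, ← hx (m .top) (by simp)]
    rw [← h.nonpos_congr (hΦm .top (by simp [Fml.atoms]))]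
    exact h.not_nonpos_top
  refine ⟨Σ i : Fin n, Fin (y' i), inferInstance, ?_, fun j => w j.1, ?_, ?_⟩
  · rw [← Fintype.card_pos_iff]
    rw [← hcard] at hpos
    exact_mod_cast hpos
  · rintro ⟨i, k⟩
    by_cases hi : sat i
    · exact (hw i hi).1
    · exact absurd k.2 (by simp [y', hi])
  · rwa [← φ.holds_congr fun e he => ?_]
    rw [hvec e he, hx _ (Finset.mem_union_left _ (Finset.mem_union_left _
      (List.mem_toFinset.2 (List.mem_map_of_mem he)))), ← hev_nonpos, frequencyValuation, hcard]
    have e₁ : (e.terms.map fun p => (p.1 : ℝ) *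
        ((Nat.card {j : Σ i : Fin n, Fin (y' i) // p.2.Holds (w j.1)} : ℝ) / ev (m .top))).sum
        = (e.terms.map fun p => (p.1 : ℝ) * ev (m p.2)).sum / ev (m .top) := by
      rw [div_eq_mul_inv, ← List.sum_map_mul_right]
      congr 1
      refine List.map_congr_left fun p hp => ?_
      rw [hcount p.2 (hl e he p hp)]
      ring
    rw [e₁, div_le_iff₀ hpos]
    have e₂ : ev (vec e) = (e.terms.map fun p => (p.1 : ℝ) * ev (m p.2)).sum
        - e.bound * ev (m .top) := by
      simp only [vec, map_sub, map_zsmul, map_list_sum, List.map_map, Function.comp_def]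
      simp only [zsmul_eq_mul]
    rw [e₂, sub_nonpos]

/-! ### The coin measure -/

instance : IsProbabilityMeasure coinMeasure := by unfold coinMeasure; infer_instance

theorem isOpen_of_agree {A : Set (ℕ → Bool)}
    (h : ∀ r ∈ A, ∃ n, ∀ r' : ℕ → Bool, (∀ i < n, r' i = r i) → r' ∈ A) : IsOpen A := by
  rw [isOpen_iff_forall_mem_open]
  intro r hr
  obtain ⟨n, hn⟩ := h r hr
  refine ⟨Set.pi (Finset.range n) fun i => {r i}, fun r' hr' => hn r' fun i hi => ?_,
    isOpen_set_pi (Finset.finite_toSet _) fun i _ => isOpen_discrete _, by simp⟩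
  exact hr' i (by simpa using hi)

theorem coinMeasure_agree_ne_zero (r : ℕ → Bool) (n : ℕ) :
    coinMeasure {r' | ∀ i < n, r' i = r i} ≠ 0 := by
  have e : {r' : ℕ → Bool | ∀ i < n, r' i = r i} = Set.pi (Finset.range n) fun i => {r i} := by
    ext r'; simp
  rw [e, coinMeasure, Measure.infinitePi_pi _ (fun i _ => MeasurableSet.singleton _)]
  refine Finset.prod_ne_zero_iff.2 fun i _ => ?_
  rw [PMF.toMeasure_apply_singleton _ _ (MeasurableSet.singleton _)]
  simp

/-- The bit sequence with first bit `b` and remaining bits `r`. -/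
def consBit (b : Bool) (r : ℕ → Bool) : ℕ → Bool
  | 0 => b
  | i + 1 => r i

theorem measurable_consBit (b : Bool) : Measurable (consBit b) := by
  rw [measurable_pi_iff]
  intro i
  cases i with
  | zero => exact measurable_const
  | succ i => exact measurable_pi_apply i

/-- Both sides agree on boxes, which determine the product measure. This permits conditioning on one
random bit at a time. -/
theorem coinMeasure_eq_half_add_half : coinMeasure =
    (2⁻¹ : ENNReal) • coinMeasure.map (consBit false) +
      (2⁻¹ : ENNReal) • coinMeasure.map (consBit true) := by
  classical
  symm
  conv_rhs => rw [coinMeasure]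
  refine Measure.eq_infinitePi _ fun s t ht => ?_
  have hmeas : MeasurableSet (Set.pi (s : Set ℕ) t) :=
    MeasurableSet.pi s.countable_toSet fun i _ => ht i
  have hbit : ∀ b, coinMeasure (consBit b ⁻¹' Set.pi s t) =
      if 0 ∈ s → b ∈ t 0 then
        ∏ i ∈ s.preimage Nat.succ Nat.succ_injective.injOn,
          (PMF.uniformOfFintype Bool).toMeasure (t (i + 1)) else 0 := by
    intro b
    have hmem : ∀ r, r ∈ consBit b ⁻¹' Set.pi s t ↔ (0 ∈ s → b ∈ t 0) ∧
        r ∈ Set.pi (s.preimage Nat.succ Nat.succ_injective.injOn : Finset ℕ)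
          fun i => t (i + 1) := by
      intro r
      simp only [Set.mem_preimage, Set.mem_pi, Finset.mem_coe, Finset.mem_preimage]
      constructor
      · intro h
        exact ⟨h 0, fun i hi => h (i + 1) hi⟩
      · rintro ⟨h₀, h₁⟩ (_ | i) hi
        · exact h₀ hi
        · exact h₁ i hi
    split_ifs with hb
    · rw [← Measure.infinitePi_pi (fun _ : ℕ => (PMF.uniformOfFintype Bool).toMeasure)
        (fun i _ => ht (i + 1)), coinMeasure]
      congr 1
      ext r
      rw [hmem]
      exact and_iff_right hb
    · rw [Set.eq_empty_of_forall_notMem (s := consBit b ⁻¹' Set.pi s t)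
        fun r hr => hb ((hmem r).1 hr).1, measure_empty]
  have hprod : ∀ f : ℕ → ENNReal, ∏ i ∈ s, f i =
      (if 0 ∈ s then f 0 else 1) *
        ∏ i ∈ s.preimage Nat.succ Nat.succ_injective.injOn, f (i + 1) := by
    intro f
    have h₁ := Finset.prod_preimage Nat.succ s Nat.succ_injective.injOn
      (fun i => if i = 0 then 1 else f i) (by
        intro i _ hi
        cases i with
        | zero => simp
        | succ i => exact absurd ⟨i, rfl⟩ hi)
    simp only [Nat.succ_eq_add_one, Nat.add_eq_zero_iff, one_ne_zero, and_false, if_false] at h₁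
    rw [h₁, ← Finset.prod_ite_eq' s 0 f, ← Finset.prod_mul_distrib]
    refine Finset.prod_congr rfl fun i _ => ?_
    split_ifs <;> simp
  rw [Measure.add_apply, Measure.smul_apply, Measure.smul_apply,
    Measure.map_apply (measurable_consBit _) hmeas, Measure.map_apply (measurable_consBit _) hmeas,
    hbit, hbit, hprod fun i => (PMF.uniformOfFintype Bool).toMeasure (t i)]
  simp only [smul_eq_mul]
  by_cases h0 : 0 ∈ s
  · simp only [h0, if_true, forall_const]
    rw [PMF.toMeasure_apply_fintype]
    simp only [Fintype.sum_bool, Set.indicator_apply, PMF.uniformOfFintype_apply,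
      Fintype.card_bool, Nat.cast_ofNat]
    split_ifs <;> simp [add_mul]
  · simp only [h0, false_imp_iff, if_true, if_false, one_mul]
    rw [← add_mul, ENNReal.inv_two_add_inv_two, one_mul]

theorem coinMeasure_real_eq_half_add_half {A : Set (ℕ → Bool)} (hA : MeasurableSet A) :
    coinMeasure.real A = 2⁻¹ * coinMeasure.real {r | consBit false r ∈ A} +
      2⁻¹ * coinMeasure.real {r | consBit true r ∈ A} := by
  have h : coinMeasure A = 2⁻¹ * coinMeasure {r | consBit false r ∈ A} +
      2⁻¹ * coinMeasure {r | consBit true r ∈ A} := by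
    conv_lhs => rw [coinMeasure_eq_half_add_half]
    rw [Measure.add_apply, Measure.smul_apply, Measure.smul_apply,
      Measure.map_apply (measurable_consBit _) hA, Measure.map_apply (measurable_consBit _) hA]
    rfl
  simp only [measureReal_def, h]
  rw [ENNReal.toReal_add (by finiteness) (by finiteness)]
  simp

/-! ### Runs and finite prefixes of the random tape -/

theorem writeUnder_self (α : LInt) (tape : ℕ → Bool) (i : ℕ) :
    writeUnder α tape i (tape i) = tape := by
  simp [writeUnder]

namespace ProbModel

variable (T : ProbModel)

theorem step_congr (α : LInt) {r r' : ℕ → Bool} {c : T.Config}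
    (h : r' c.randHead = r c.randHead) : T.step α r' c = T.step α r c := by
  simp [step, h]

theorem exists_randHead_lt_of_mem_eval {α : LInt} {r : ℕ → Bool} {a b : T.Config}
    (h : b ∈ StateTransition.eval (T.step α r) a) :
    ∃ n, ∀ c, StateTransition.Reaches (T.step α r) a c → c.randHead < n := by
  obtain ⟨hab, hb⟩ := StateTransition.mem_eval.1 h
  clear h
  induction hab using Relation.ReflTransGen.head_induction_on with
  | refl =>
    refine ⟨b.randHead + 1, fun c hc => ?_⟩
    rcases Relation.ReflTransGen.cases_head hc with rfl | ⟨d, hd, _⟩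
    · lia
    · simp [hb] at hd
  | @head a' c' hac _ ih =>
    obtain ⟨n, hn⟩ := ih
    refine ⟨max n (a'.randHead + 1), fun c hc => ?_⟩
    rcases Relation.ReflTransGen.cases_head hc with rfl | ⟨d, hd, hdc⟩
    · lia
    · cases Option.mem_unique hd hac
      exact lt_of_lt_of_le (hn c hdc) (le_max_left _ _)

theorem mem_eval_congr {α : LInt} {r r' : ℕ → Bool} {a b : T.Config} {n : ℕ}
    (hb : b ∈ StateTransition.eval (T.step α r) a)
    (hn : ∀ c, StateTransition.Reaches (T.step α r) a c → c.randHead < n)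
    (h : ∀ i < n, r' i = r i) : b ∈ StateTransition.eval (T.step α r') a := by
  rw [StateTransition.mem_eval] at hb ⊢
  obtain ⟨hab, hb⟩ := hb
  refine ⟨?_, by rw [T.step_congr α (h _ (hn b hab)), hb]⟩
  clear hb
  induction hab with
  | refl => exact .refl
  | tail hac hcd ih =>
    refine .tail ih ?_
    rwa [T.step_congr α (h _ (hn _ hac))]

theorem haltsWith_of_agree {α : LInt} {r : ℕ → Bool} {t : ℕ → Bool} (h : T.HaltsWith α r t) :
    ∃ n, ∀ r' : ℕ → Bool, (∀ i < n, r' i = r i) → T.HaltsWith α r' t := by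
  obtain ⟨b, hb, ht⟩ := h
  obtain ⟨n, hn⟩ := T.exists_randHead_lt_of_mem_eval hb
  exact ⟨n, fun r' hr' => ⟨b, T.mem_eval_congr hb hn hr', ht⟩⟩

theorem haltsWith_unique {α : LInt} {r : ℕ → Bool} {t t' : ℕ → Bool}
    (h : T.HaltsWith α r t) (h' : T.HaltsWith α r t') : t = t' := by
  obtain ⟨b, hb, rfl⟩ := h
  obtain ⟨b', hb', rfl⟩ := h'
  rw [Part.mem_unique hb hb']

/-- Halting with a given outcome is witnessed by a finite prefix of the random tape, so the atoms
define open sets. -/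
theorem measurableSet_satWith (φ : LNonProb) : MeasurableSet {r | T.SatWith r φ} := by
  induction φ with
  | atom a =>
    refine (isOpen_of_agree ?_).measurableSet
    rintro r ⟨t, ht, hβ⟩
    obtain ⟨n, hn⟩ := T.haltsWith_of_agree ht
    exact ⟨n, fun r' hr' => ⟨t, hn r' hr', hβ⟩⟩
  | top => simp [SatWith, Fml.Holds]
  | neg φ ih => exact ih.compl
  | and φ ψ ih ih' => exact ih.inter ih'
  | or φ ψ ih ih' => exact ih.union ih'

/-! ### Truncation of a probabilistic model to a finite random prefix -/

/-- The non-probabilistic model that runs `T` on the first `n` bits of the random tape `r`. When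
the random tape head leaves this prefix, it loops if `loop` is `true` and halts otherwise. -/
def truncate (r : ℕ → Bool) (n : ℕ) (loop : Bool) : NonProbModel where
  -- The extra position `n` records that the random head has left the prefix; a move changes the
  -- position by at most one.
  State := T.State × Fin (n + 1)
  finite_state := by
    have := T.finite_state
    infer_instance
  start := (T.start, 0)
  trans s b :=
    if h : s.2.1 < n then
      (T.trans s.1 b (r s.2.1)).map fun (q, b', m, m') =>
        ((q, ⟨m'.apply s.2.1, by cases m' <;> simp only [Move.apply] <;> lia⟩), b', m)
    else if loop then some (s, b, .stay) else none

variable {T} {r : ℕ → Bool} {n : ℕ} {loop : Bool}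

/-- The configuration of a model that corresponds to a configuration of its truncation. -/
def ofTruncate (c : (T.truncate r n loop).Config) : T.Config :=
  ⟨c.state.1, c.tape, c.head, c.state.2.1⟩

theorem step_ofTruncate (α : LInt) {c : (T.truncate r n loop).Config} (h : c.state.2.1 < n) :
    T.step α r (ofTruncate c) = ((T.truncate r n loop).step α c).map ofTruncate := by
  rw [NonProbModel.step,
    show (T.truncate r n loop).trans c.state (c.tape c.head) = _ from dif_pos h]
  change Option.map _ (T.trans c.state.1 (c.tape c.head) (r c.state.2.1)) = _
  generalize T.trans c.state.1 (c.tape c.head) (r c.state.2.1) = o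
  cases o <;> rfl

theorem step_truncate_of_not_lt (α : LInt) {c : (T.truncate r n loop).Config}
    (h : ¬ c.state.2.1 < n) :
    (T.truncate r n loop).step α c = if loop then some c else none := by
  simp only [NonProbModel.step, truncate, h, dif_neg, not_false_eq_true]
  cases loop
  · rfl
  · simp only [if_true, Option.map_some, writeUnder_self, Move.apply]
    rfl

theorem reaches_ofTruncate {α : LInt} {a b : (T.truncate r n loop).Config}
    (h : StateTransition.Reaches ((T.truncate r n loop).step α) a b) :
    StateTransition.Reaches (T.step α r) (ofTruncate a) (ofTruncate b) := by
  induction h with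
  | refl => exact .refl
  | @tail c d _ hcd ih =>
    by_cases hc : c.state.2.1 < n
    · refine .tail ih ?_
      rw [step_ofTruncate α hc, Option.mem_def.1 hcd]
      rfl
    · rw [step_truncate_of_not_lt α hc] at hcd
      cases loop <;> simp at hcd
      rwa [← hcd]

/-- The simulated tape `r'` need only share the prefix with `r`; `truncate_alwaysHalting` needs this
freedom, as `T` may fail to halt on `r` itself. -/
theorem reaches_truncate {α : LInt} {r' : ℕ → Bool} (hr : ∀ i < n, r' i = r i)
    {a : (T.truncate r n loop).Config} {b : T.Config}
    (h : StateTransition.Reaches (T.step α r') (ofTruncate a) b) :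
    ∃ b', StateTransition.Reaches ((T.truncate r n loop).step α) a b' ∧
      (ofTruncate b' = b ∨ ¬ b'.state.2.1 < n) := by
  induction h with
  | refl => exact ⟨a, .refl, Or.inl rfl⟩
  | tail _ hcd ih =>
    obtain ⟨c', hac', rfl | hc'⟩ := ih
    · by_cases hlt : c'.state.2.1 < n
      · rw [T.step_congr α (c := ofTruncate c') (hr _ hlt), step_ofTruncate α hlt] at hcd
        obtain ⟨d', hd', rfl⟩ := Option.mem_map.1 hcd
        exact ⟨d', .tail hac' hd', Or.inl rfl⟩
      · exact ⟨c', hac', Or.inr hlt⟩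
    · exact ⟨c', hac', Or.inr hc'⟩

theorem truncate_haltsWith {α : LInt} {t : ℕ → Bool} (h : T.HaltsWith α r t)
    (hn : ∀ c, StateTransition.Reaches (T.step α r) (T.init α) c → c.randHead < n) :
    (T.truncate r n loop).HaltsWith α t := by
  obtain ⟨b, hb, rfl⟩ := h
  obtain ⟨hab, hb⟩ := StateTransition.mem_eval.1 hb
  obtain ⟨b', hab', hb'⟩ := reaches_truncate (a := (T.truncate r n loop).init α)
    (fun _ _ => rfl) hab
  have hlt : b'.state.2.1 < n := hn _ (reaches_ofTruncate hab')
  have hb' := hb'.resolve_right (not_not.2 hlt)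
  subst hb'
  refine ⟨b', StateTransition.mem_eval.2 ⟨hab', ?_⟩, rfl⟩
  rw [step_ofTruncate α hlt] at hb
  simpa using hb

theorem haltsWith_of_truncate {α : LInt} {t : ℕ → Bool}
    (h : (T.truncate r n true).HaltsWith α t) : T.HaltsWith α r t := by
  obtain ⟨b, hb, rfl⟩ := h
  obtain ⟨hab, hb⟩ := StateTransition.mem_eval.1 hb
  refine ⟨ofTruncate b, StateTransition.mem_eval.2 ⟨reaches_ofTruncate hab, ?_⟩, rfl⟩
  by_cases hlt : b.state.2.1 < n
  · rw [step_ofTruncate α hlt, hb]; rfl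
  · rw [step_truncate_of_not_lt α hlt] at hb
    simp at hb

/-- The tapes that share the prefix have positive measure, so `T` halts on one of them. The
truncation follows that run until it halts or leaves the prefix, where the truncation halts too. -/
theorem truncate_alwaysHalting (hT : T.AlmostSurelyHalting) :
    (T.truncate r n false).AlwaysHalting := by
  intro α
  obtain ⟨r', hr', t, b, hb, -⟩ : ∃ r', (∀ i < n, r' i = r i) ∧ ∃ t, T.HaltsWith α r' t := by
    by_contra! hcon
    refine coinMeasure_agree_ne_zero r n (measure_mono_null (fun r' hr' => ?_) (hT α))
    simpa using hcon r' hr'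
  obtain ⟨hab, hb⟩ := StateTransition.mem_eval.1 hb
  obtain ⟨b', hab', hb'⟩ := reaches_truncate (loop := false)
    (a := (T.truncate r n false).init α) hr' hab
  refine ⟨b'.tape, b', StateTransition.mem_eval.2 ⟨hab', ?_⟩, rfl⟩
  by_cases hlt : b'.state.2.1 < n
  · obtain rfl := hb'.resolve_right (not_not.2 hlt)
    rw [T.step_congr α (c := ofTruncate b') (hr' _ hlt), step_ofTruncate α hlt] at hb
    simpa using hb
  · rw [step_truncate_of_not_lt α hlt]; rfl

theorem exists_common_randHead_bound (T : ProbModel) (r : ℕ → Bool) (l : List LCond) :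
    ∃ n, ∀ a ∈ l, ∀ t, T.HaltsWith a.antecedent r t →
      ∀ c, StateTransition.Reaches (T.step a.antecedent r) (T.init a.antecedent) c →
        c.randHead < n := by
  induction l with
  | nil => exact ⟨0, by simp⟩
  | cons a l ih =>
    obtain ⟨n, hn⟩ := ih
    obtain ⟨m, hm⟩ : ∃ m, ∀ t, T.HaltsWith a.antecedent r t →
        ∀ c, StateTransition.Reaches (T.step a.antecedent r) (T.init a.antecedent) c →
          c.randHead < m := by
      by_cases h : ∃ t, T.HaltsWith a.antecedent r t
      · obtain ⟨t, b, hb, -⟩ := h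
        obtain ⟨m, hm⟩ := T.exists_randHead_lt_of_mem_eval hb
        exact ⟨m, fun _ _ => hm⟩
      · exact ⟨0, fun t ht => absurd ⟨t, ht⟩ h⟩
    refine ⟨max n m, fun a' ha' t ht c hc => ?_⟩
    rcases List.mem_cons.1 ha' with rfl | ha'
    · exact lt_of_lt_of_le (hm t ht c hc) (le_max_right _ _)
    · exact lt_of_lt_of_le (hn a' ha' t ht c hc) (le_max_left _ _)

theorem satWith_of_nonProbValid {φ : LNonProb} (hφ : NonProbValid φ) (T : ProbModel)
    (r : ℕ → Bool) : T.SatWith r φ := by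
  obtain ⟨n, hn⟩ := T.exists_common_randHead_bound r φ.atoms
  refine (φ.holds_congr fun a ha => ?_).1 (hφ (T.truncate r n true))
  refine exists_congr fun t => and_congr_left fun _ => ?_
  exact ⟨haltsWith_of_truncate, fun h => truncate_haltsWith h (hn a ha t h)⟩

/-- The truncation may halt where `T` does not, so `r` is restricted to the almost sure event that
`T` halts under all antecedents in `φ`. There, both runs end with the same tape. -/
theorem satWith_of_nonProbValidHalting {φ : LNonProb} (hφ : NonProbValidHalting φ)
    {T : ProbModel} (hT : T.AlmostSurelyHalting) : ∀ᵐ r ∂coinMeasure, T.SatWith r φ := by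
  have hall : ∀ᵐ r ∂coinMeasure, ∀ a ∈ {a | a ∈ φ.atoms}, ∃ t, T.HaltsWith a.antecedent r t :=
    (Filter.eventually_all_finite φ.atoms.finite_toSet).2 fun a _ => hT a.antecedent
  filter_upwards [hall] with r hr
  obtain ⟨n, hn⟩ := T.exists_common_randHead_bound r φ.atoms
  refine (φ.holds_congr fun a ha => ?_).1 (hφ (T.truncate r n false) (truncate_alwaysHalting hT))
  refine exists_congr fun t => and_congr_left fun _ => ?_
  obtain ⟨t', ht'⟩ := hr a ha
  have htr := truncate_haltsWith (loop := false) ht' (hn a ha t' ht')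
  constructor
  · intro h
    obtain ⟨b, hb, rfl⟩ := h
    obtain ⟨b', hb', rfl⟩ := htr
    rwa [Part.mem_unique hb hb']
  · intro h
    rwa [T.haltsWith_unique h ht']

end ProbModel

/-! ### Soundness -/

/-- The axioms are sound in a model in which the formulas in `V` are almost surely true. -/
theorem Derivable.sound {V : LNonProb → Prop} {T : ProbModel}
    (hV : ∀ φ, V φ → ∀ᵐ r ∂coinMeasure, T.SatWith r φ) {φ : L} (h : Derivable V φ) :
    T.Sat φ := by
  have neg_sum : ∀ t : List (ℤ × LNonProb),
      (t.map fun p => (((-p.1 : ℤ)) : ℝ) * T.prob p.2).sum =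
        - (t.map fun p => (p.1 : ℝ) * T.prob p.2).sum := by
    intro t
    induction t with
    | nil => simp
    | cons p t ih => simp only [List.map_cons, List.sum_cons, ih]; push_cast; ring
  unfold ProbModel.Sat
  induction h with
  | taut φ h => exact h _
  | mp φ ψ _ _ ih₁ ih₂ => exact ih₁.resolve_left (not_not.2 ih₂)
  | nonNeg φ => simp [ge, le, Fml.Holds, ProbModel.prob]
  | norm =>
    have : T.prob .top = 1 := by simp [ProbModel.prob, ProbModel.SatWith, Fml.Holds]
    simp [eq, ge, le, Fml.Holds, this]
  | add φ ψ =>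
    have : T.prob (φ.and ψ) + T.prob (φ.and ψ.neg) = T.prob φ :=
      measureReal_inter_add_sdiff (T.measurableSet_satWith ψ)
    simp only [eq, ge, le, Fml.Holds, List.map_cons, List.map_nil, List.sum_cons, List.sum_nil]
    push_cast
    constructor <;> linarith
  | dist φ ψ h =>
    have : T.prob φ = T.prob ψ := by
      refine measureReal_congr ?_
      filter_upwards [hV _ h] with r hr
      simp only [ProbModel.SatWith, Fml.iff, Fml.imp, Fml.Holds] at hr
      refine propext (show T.SatWith r φ ↔ T.SatWith r ψ from ?_)
      simp only [ProbModel.SatWith]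
      tauto
    simp only [eq, ge, le, Fml.Holds, List.map_cons, List.map_nil, List.sum_cons, List.sum_nil]
    push_cast
    constructor <;> linarith
  | zero t φ c =>
    simp only [Fml.iff, Fml.imp, Fml.Holds, le, List.map_append, List.sum_append, List.map_cons,
      List.map_nil, List.sum_cons, List.sum_nil, Int.cast_zero, zero_mul, add_zero]
    tauto
  | permutation t t' c h =>
    simp only [Fml.iff, Fml.imp, Fml.Holds, le, (h.map _).sum_eq]
    tauto
  | addIneq t c c' =>
    simp only [Fml.imp, Fml.Holds, le, List.map_map, Function.comp_def]
    rw [← imp_iff_not_or]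
    rintro ⟨h₁, h₂⟩
    simp only [Int.cast_add, add_mul, List.sum_map_add]
    exact add_le_add h₁ h₂
  | mult t b c hb =>
    simp only [Fml.imp, Fml.Holds, le, List.map_map, Function.comp_def]
    rw [← imp_iff_not_or]
    intro h
    simp only [Int.cast_mul, mul_assoc, List.sum_map_mul_left]
    exact mul_le_mul_of_nonneg_left h (by exact_mod_cast hb.le)
  | dichotomy t c =>
    simp only [Fml.Holds, le, ge, List.map_map, Function.comp_def, neg_sum]
    push_cast
    rw [neg_le_neg_iff]
    exact le_total _ _
  | mono t b c hcb =>
    simp only [Fml.imp, Fml.Holds, le, lt, ge, List.map_map, Function.comp_def, neg_sum]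
    push_cast
    rw [neg_le_neg_iff, ← imp_iff_not_or, not_le]
    intro h
    exact lt_of_le_of_lt h (by exact_mod_cast hcb)

/-! ### Rejection sampling -/

/-- Reading the bits of a random tape after the bits `s` in blocks of length `K`, and decoding each
block by `dec`, the first block that is not rejected is decoded to `j`. -/
inductive Selects {ι : Type} (K : ℕ) (dec : List Bool → Option ι) (j : ι) :
    List Bool → (ℕ → Bool) → Prop
  | more (s : List Bool) (r : ℕ → Bool) : (s ++ [r 0]).length < K →
      Selects K dec j (s ++ [r 0]) (fun i => r (i + 1)) → Selects K dec j s r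
  | accept (s : List Bool) (r : ℕ → Bool) : ¬ (s ++ [r 0]).length < K →
      dec (s ++ [r 0]) = some j → Selects K dec j s r
  | reject (s : List Bool) (r : ℕ → Bool) : ¬ (s ++ [r 0]).length < K →
      dec (s ++ [r 0]) = none → Selects K dec j [] (fun i => r (i + 1)) → Selects K dec j s r

namespace Selects

variable {ι : Type} {K : ℕ} {dec : List Bool → Option ι} {j : ι}

theorem consBit_iff_of_lt {s : List Bool} {b : Bool} {r : ℕ → Bool} (h : (s ++ [b]).length < K) :
    Selects K dec j s (consBit b r) ↔ Selects K dec j (s ++ [b]) r := by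
  constructor
  · intro hs
    cases hs with
    | more _ _ _ h' => exact h'
    | accept _ _ h' => exact absurd h h'
    | reject _ _ h' => exact absurd h h'
  · exact fun hs => .more s (consBit b r) h hs

theorem consBit_iff_of_not_lt {s : List Bool} {b : Bool} {r : ℕ → Bool}
    (h : ¬ (s ++ [b]).length < K) :
    Selects K dec j s (consBit b r) ↔
      dec (s ++ [b]) = some j ∨ dec (s ++ [b]) = none ∧ Selects K dec j [] r := by
  constructor
  · intro hs
    cases hs with
    | more _ _ h' => exact absurd h' h
    | accept _ _ _ h' => exact Or.inl h'
    | reject _ _ _ h' h'' => exact Or.inr ⟨h', h''⟩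
  · rintro (h' | ⟨h', h''⟩)
    · exact .accept s (consBit b r) h h'
    · exact .reject s (consBit b r) h h' h''

theorem of_agree {s : List Bool} {r : ℕ → Bool} (h : Selects K dec j s r) :
    ∃ n, ∀ r' : ℕ → Bool, (∀ i < n, r' i = r i) → Selects K dec j s r' := by
  induction h with
  | more s r hlt _ ih =>
    obtain ⟨n, hn⟩ := ih
    refine ⟨n + 1, fun r' hr' => ?_⟩
    have h0 : r' 0 = r 0 := hr' 0 (by lia)
    refine .more s r' (by rwa [h0]) ?_
    rw [h0]
    exact hn _ fun i hi => hr' (i + 1) (by lia)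
  | accept s r hlt hdec =>
    refine ⟨1, fun r' hr' => ?_⟩
    have h0 : r' 0 = r 0 := hr' 0 (by lia)
    exact .accept s r' (by rwa [h0]) (by rwa [h0])
  | reject s r hlt hdec _ ih =>
    obtain ⟨n, hn⟩ := ih
    refine ⟨n + 1, fun r' hr' => ?_⟩
    have h0 : r' 0 = r 0 := hr' 0 (by lia)
    exact .reject s r' (by rwa [h0]) (by rwa [h0]) (hn _ fun i hi => hr' (i + 1) (by lia))

theorem measurableSet (s : List Bool) : MeasurableSet {r | Selects K dec j s r} :=
  (isOpen_of_agree fun _ h => of_agree h).measurableSet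

theorem unique {s : List Bool} {r : ℕ → Bool} {j' : ι} (h : Selects K dec j s r)
    (h' : Selects K dec j' s r) : j = j' := by
  induction h with
  | more s r hlt _ ih =>
    cases h' with
    | more _ _ _ h' => exact ih h'
    | accept _ _ h' => exact absurd hlt h'
    | reject _ _ h' => exact absurd hlt h'
  | accept s r hlt hdec =>
    cases h' with
    | more _ _ h' => exact absurd h' hlt
    | accept _ _ _ h' => exact Option.some_injective _ (hdec.symm.trans h')
    | reject _ _ _ h' => simp [hdec] at h'
  | reject s r hlt hdec _ ih =>
    cases h' with
    | more _ _ h' => exact absurd h' hlt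
    | accept _ _ _ h' => simp [hdec] at h'
    | reject _ _ _ _ h' => exact ih h'

/-- The probability of selecting `j` after the bits `s` is an average over the completions of `s`
to a block. -/
theorem prob_eq_sum {m : ℕ} {s : List Bool} (hs : s.length + (m + 1) = K) :
    coinMeasure.real {r | Selects K dec j s r} =
      (∑ w : Fin (m + 1) → Bool, coinMeasure.real {r | dec (s ++ List.ofFn w) = some j ∨
        dec (s ++ List.ofFn w) = none ∧ Selects K dec j [] r}) / 2 ^ (m + 1) := by
  have hsum : ∀ {k : ℕ} (f : (Fin (k + 1) → Bool) → ℝ), ∑ w, f w =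
      ∑ w, f (Fin.cons true w) + ∑ w, f (Fin.cons false w) := by
    intro k f
    rw [← (Fin.consEquiv fun _ => Bool).sum_comp, Fintype.sum_prod_type, Fintype.sum_bool]
    rfl
  induction m generalizing s with
  | zero =>
    have hlt : ∀ b, ¬ (s ++ [b]).length < K := by intro b; simp; lia
    rw [coinMeasure_real_eq_half_add_half (measurableSet s), hsum]
    simp only [Set.mem_ofPred_eq, consBit_iff_of_not_lt (hlt _), Finset.univ_unique,
      Finset.sum_singleton]
    simp
    ring
  | succ m ih =>
    have hlt : ∀ b, (s ++ [b]).length < K := by intro b; simp; lia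
    rw [coinMeasure_real_eq_half_add_half (measurableSet s), hsum]
    simp only [Set.mem_ofPred_eq, consBit_iff_of_lt (hlt _)]
    rw [ih (s := s ++ [false]) (by simp; lia), ih (s := s ++ [true]) (by simp; lia)]
    simp only [List.append_assoc, List.cons_append, List.nil_append, List.ofFn_cons]
    field_simp
    ring

/-- If each `j` is the value of exactly one block, then all are selected with equal
probability. -/
theorem prob_eq_inv_card [Fintype ι] (hK : 0 < K)
    (hdec : ∀ j, ∃! w : Fin K → Bool, dec (List.ofFn w) = some j) (j : ι) :
    coinMeasure.real {r | Selects K dec j [] r} = (Fintype.card ι : ℝ)⁻¹ := by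
  classical
  obtain ⟨m, rfl⟩ : ∃ m, K = m + 1 := ⟨K - 1, by lia⟩
  set p := coinMeasure.real {r | Selects (m + 1) dec j [] r} with hp
  have h := prob_eq_sum (dec := dec) (j := j) (K := m + 1) (m := m) (s := []) (by simp)
  rw [← hp] at h
  -- A block contributes `1` if it codes `j`, restarts the experiment with probability `p` if
  -- rejected, and contributes `0` otherwise.
  have hterm : ∀ w : Fin (m + 1) → Bool,
      coinMeasure.real {r | dec ([] ++ List.ofFn w) = some j ∨
        dec ([] ++ List.ofFn w) = none ∧ Selects (m + 1) dec j [] r} =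
      (if dec (List.ofFn w) = some j then 1 else 0) +
        (if dec (List.ofFn w) = none then p else 0) := by
    intro w
    rw [List.nil_append]
    cases hw : dec (List.ofFn w) with
    | none => simp [hp]
    | some i =>
      by_cases hij : i = j
      · simp [hij]
      · simp [hij]
  have hone : ∀ i, (Finset.univ.filter fun w : Fin (m + 1) → Bool =>
      dec (List.ofFn w) = some i).card = 1 := by
    intro i
    obtain ⟨w, hw, huniq⟩ := hdec i
    rw [Finset.card_eq_one]
    refine ⟨w, ?_⟩
    ext w'
    simp only [Finset.mem_filter, Finset.mem_univ, true_and, Finset.mem_singleton]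
    exact ⟨huniq w', fun h => h ▸ hw⟩
  have hcard : (2 : ℝ) ^ (m + 1) = (Finset.univ.filter fun w : Fin (m + 1) → Bool =>
      dec (List.ofFn w) = none).card + Fintype.card ι := by
    have := Finset.card_eq_sum_card_fiberwise (s := (Finset.univ : Finset (Fin (m + 1) → Bool)))
      (t := (Finset.univ : Finset (Option ι))) (f := fun w => dec (List.ofFn w)) (by simp)
    rw [Fintype.sum_option] at this
    simp only [hone, Finset.card_univ, Fintype.card_fun, Fintype.card_bool, Fintype.card_fin,
      Finset.sum_const, smul_eq_mul, mul_one] at this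
    exact_mod_cast this
  -- With `R` rejected blocks, `p * 2 ^ (m + 1) = 1 + R * p` and `2 ^ (m + 1) = R + |ι|`, whence `p
  -- * |ι| = 1`.
  rw [Finset.sum_congr rfl fun w _ => hterm w, Finset.sum_add_distrib, Finset.sum_boole,
    ← Finset.sum_filter, Finset.sum_const, nsmul_eq_mul, hone, eq_div_iff (by positivity),
    hcard] at h
  push_cast at h
  refine eq_inv_of_mul_eq_one_left ?_
  linarith

end Selects

/-- One-hot codes of length `|ι|` suffice; all other blocks are rejected. -/
theorem exists_block_decoding (ι : Type) [Fintype ι] [Nonempty ι] :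
    ∃ K, 0 < K ∧ ∃ dec : List Bool → Option ι,
      ∀ j, ∃! w : Fin K → Bool, dec (List.ofFn w) = some j := by
  classical
  let e := Fintype.equivFin ι
  let code : ι → List Bool := fun j => List.ofFn fun k => decide (k = e j)
  have hcode : Function.Injective code := by
    intro i j hij
    have := congrFun (List.ofFn_injective hij) (e i)
    simpa using this
  refine ⟨Fintype.card ι, Fintype.card_pos,
    fun s => if h : ∃ j, code j = s then some h.choose else none, fun j => ?_⟩
  have hdec : ∀ s, (if h : ∃ j, code j = s then some h.choose else none) = some j ↔
      s = code j := by
    intro s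
    constructor
    · intro h
      split_ifs at h with hs
      rw [← Option.some_injective _ h, hs.choose_spec]
    · rintro rfl
      have hs : ∃ i, code i = code j := ⟨j, rfl⟩
      rw [dif_pos hs, hcode hs.choose_spec]
  simp only [hdec]
  exact ⟨fun k => decide (k = e j), rfl, fun w hw => List.ofFn_injective hw⟩

/-! ### Mixtures of non-probabilistic models -/

section Mixture

variable {ι : Type} [Finite ι] (T : ι → NonProbModel) {K : ℕ} (hK : 0 < K)
  (dec : List Bool → Option ι)

/-- The state of the mixture of the models `T` after the bits `s` have been read. -/
def mixtureNext (s : List Bool) : {s : List Bool // s.length < K} ⊕ (Σ j, (T j).State) :=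
  if h : s.length < K then .inl ⟨s, h⟩ else
    match dec s with
    | some j => .inr ⟨j, (T j).start⟩
    | none => .inl ⟨[], hK⟩

/-- The probabilistic model that selects a non-probabilistic model by rejection sampling and runs
it. -/
def mixture : ProbModel where
  State := {s : List Bool // s.length < K} ⊕ (Σ j, (T j).State)
  finite_state := by
    have := fun j => (T j).finite_state
    have : Finite {s : List Bool // s.length < K} := (List.finite_length_lt Bool K).to_subtype
    infer_instance
  start := .inl ⟨[], hK⟩
  trans
    -- Sampling rewrites the scanned bit and keeps the head in place, so the selected model starts
    -- on the untouched initial tape.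
    | .inl s, m, b => some (mixtureNext T hK dec (s.1 ++ [b]), m, .stay, .right)
    | .inr ⟨j, q⟩, m, _ =>
      ((T j).trans q m).map fun (q', b', mv) => (.inr ⟨j, q'⟩, b', mv, .stay)

theorem mixture_step_inl (α : LInt) (r : ℕ → Bool) (s : {s : List Bool // s.length < K})
    (tape : ℕ → Bool) (i h : ℕ) :
    (mixture T hK dec).step α r ⟨.inl s, tape, i, h⟩ =
      some ⟨mixtureNext T hK dec (s.1 ++ [r h]), tape, i, h + 1⟩ := by
  simp only [ProbModel.step, mixture, Option.map_some, writeUnder_self, Move.apply]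

theorem mixture_step_inr (α : LInt) (r : ℕ → Bool) (j : ι) (h : ℕ) (c : (T j).Config) :
    (mixture T hK dec).step α r ⟨.inr ⟨j, c.state⟩, c.tape, c.head, h⟩ =
      ((T j).step α c).map fun c => ⟨.inr ⟨j, c.state⟩, c.tape, c.head, h⟩ := by
  change Option.map _ (Option.map _ ((T j).trans c.state (c.tape c.head))) =
    Option.map _ (Option.map _ ((T j).trans c.state (c.tape c.head)))
  generalize (T j).trans c.state (c.tape c.head) = o
  cases o <;> rfl

variable {T hK dec}

theorem mixture_reaches_of_selects (α : LInt) {r : ℕ → Bool} {j : ι} {s : List Bool}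
    {r' : ℕ → Bool} (hsel : Selects K dec j s r') (hs : s.length < K) (tape : ℕ → Bool)
    (i h : ℕ) (hr : ∀ k, r' k = r (h + k)) :
    ∃ h', StateTransition.Reaches ((mixture T hK dec).step α r) ⟨.inl ⟨s, hs⟩, tape, i, h⟩
      ⟨.inr ⟨j, (T j).start⟩, tape, i, h'⟩ := by
  induction hsel generalizing h with
  | more s r' hlt _ ih =>
    obtain ⟨h', hh'⟩ := ih hlt (h + 1) fun k =>
      (hr (k + 1)).trans (congrArg r (by lia))
    refine ⟨h', .head ?_ hh'⟩
    have h0 : r' 0 = r h := hr 0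
    simp only [h0] at hlt ⊢
    rw [mixture_step_inl, mixtureNext, dif_pos hlt]
    rfl
  | accept s r' hlt hdec =>
    refine ⟨h + 1, .single ?_⟩
    have h0 : r' 0 = r h := hr 0
    rw [h0] at hlt hdec
    rw [mixture_step_inl, mixtureNext, dif_neg hlt, hdec]
    rfl
  | reject s r' hlt hdec _ ih =>
    obtain ⟨h', hh'⟩ := ih hK (h + 1) fun k =>
      (hr (k + 1)).trans (congrArg r (by lia))
    refine ⟨h', .head ?_ hh'⟩
    have h0 : r' 0 = r h := hr 0
    rw [h0] at hlt hdec
    rw [mixture_step_inl, mixtureNext, dif_neg hlt, hdec]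
    rfl

/-- Once `j` is selected, the random head stays fixed and the steps of the mixture are the embedded
steps of `T j`, so the evaluations correspond. -/
theorem mixture_haltsWith_iff {α : LInt} {r t : ℕ → Bool} {j : ι}
    (hsel : Selects K dec j [] r) :
    (mixture T hK dec).HaltsWith α r t ↔ (T j).HaltsWith α t := by
  obtain ⟨h, hh⟩ := mixture_reaches_of_selects (T := T) (hK := hK) (r := r) α hsel hK
    (initTape α) 0 0 (fun k => by simp)
  have heval : StateTransition.eval ((mixture T hK dec).step α r) ((mixture T hK dec).init α) =
      (fun c : (T j).Config => (⟨.inr ⟨j, c.state⟩, c.tape, c.head, h⟩ :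
        (mixture T hK dec).Config)) <$> StateTransition.eval ((T j).step α) ((T j).init α) := by
    refine (StateTransition.reaches_eval hh).trans
      (StateTransition.tr_eval' ((T j).step α) ((mixture T hK dec).step α r)
        (fun c : (T j).Config => (⟨.inr ⟨j, c.state⟩, c.tape, c.head, h⟩ :
          (mixture T hK dec).Config)) ?_ ((T j).init α))
    rw [StateTransition.fun_respects]
    intro c
    have hstep := mixture_step_inr T hK dec α r j h c
    cases hc : (T j).step α c with
    | none =>
      rw [hc] at hstep
      exact hstep
    | some c' =>
      rw [hc] at hstep
      exact .single hstep
  unfold ProbModel.HaltsWith NonProbModel.HaltsWith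
  rw [heval]
  constructor
  · rintro ⟨c, hc, rfl⟩
    obtain ⟨c', hc', rfl⟩ := (Part.mem_map_iff _).1 hc
    exact ⟨c', hc', rfl⟩
  · rintro ⟨c, hc, rfl⟩
    exact ⟨_, (Part.mem_map_iff _).2 ⟨c, hc, rfl⟩, rfl⟩

theorem mixture_satWith_iff {r : ℕ → Bool} {j : ι} (hsel : Selects K dec j [] r)
    (φ : LNonProb) : (mixture T hK dec).SatWith r φ ↔ (T j).Sat φ :=
  φ.holds_congr fun _ _ => exists_congr fun _ => and_congr_left fun _ =>
    mixture_haltsWith_iff hsel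

end Mixture

/-- A uniform mixture of finitely many non-probabilistic models is a probabilistic model. -/
theorem exists_probModel_prob_eq {ι : Type} [Fintype ι] [Nonempty ι] (T : ι → NonProbModel) :
    ∃ M : ProbModel,
      (∀ φ, M.prob φ = (Nat.card {j // (T j).Sat φ} : ℝ) / Fintype.card ι) ∧
      ((∀ j, (T j).AlwaysHalting) → M.AlmostSurelyHalting) := by
  classical
  obtain ⟨K, hK, dec, hdec⟩ := exists_block_decoding ι
  have hprob := Selects.prob_eq_inv_card hK hdec
  have hunion : ∀ s : Finset ι, coinMeasure.real (⋃ j ∈ s, {r | Selects K dec j [] r}) =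
      s.card / Fintype.card ι := by
    intro s
    rw [measureReal_biUnion_finset]
    · rw [Finset.sum_congr rfl fun j _ => hprob j]
      simp [div_eq_mul_inv]
    · intro i _ j _ hij
      exact Set.disjoint_left.2 fun r hi hj => hij (Selects.unique hi hj)
    · exact fun j _ => Selects.measurableSet []
  -- The selection events are disjoint and their probabilities sum to `1`, so endless rejection is a
  -- null event.
  have hall : ∀ᵐ r ∂coinMeasure, ∃ j, Selects K dec j [] r := by
    have h₁ := hunion Finset.univ
    rw [Finset.card_univ, div_self (by exact_mod_cast Fintype.card_ne_zero)] at h₁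
    have h₂ : MeasurableSet (⋃ j ∈ (Finset.univ : Finset ι), {r | Selects K dec j [] r}) :=
      Finset.measurableSet_biUnion _ fun j _ => Selects.measurableSet []
    have h₃ : coinMeasure (⋃ j ∈ (Finset.univ : Finset ι), {r | Selects K dec j [] r}) = 1 := by
      rwa [measureReal_def, ENNReal.toReal_eq_one_iff] at h₁
    filter_upwards [(mem_ae_iff_prob_eq_one h₂).2 h₃] with r hr
    simpa using hr
  refine ⟨mixture T hK dec, fun φ => ?_, fun hT α => ?_⟩
  · have hae : {r | (mixture T hK dec).SatWith r φ} =ᵐ[coinMeasure]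
        ⋃ j ∈ Finset.univ.filter (fun j => (T j).Sat φ), {r | Selects K dec j [] r} := by
      filter_upwards [hall] with r ⟨j, hj⟩
      refine propext (show (mixture T hK dec).SatWith r φ ↔
        r ∈ ⋃ j ∈ Finset.univ.filter (fun j => (T j).Sat φ), {r | Selects K dec j [] r} from ?_)
      rw [mixture_satWith_iff hj]
      simp only [Set.mem_iUnion, Finset.mem_filter, Finset.mem_univ, true_and, exists_prop,
        Set.mem_ofPred_eq]
      constructor
      · exact fun h => ⟨j, h, hj⟩
      · rintro ⟨i, hi, hri⟩
        rwa [Selects.unique hj hri]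
    rw [ProbModel.prob, measureReal_congr hae, hunion, Nat.card_eq_fintype_card,
      Fintype.card_subtype]
  · filter_upwards [hall] with r ⟨j, hj⟩
    obtain ⟨t, ht⟩ := hT j α
    exact ⟨t, (mixture_haltsWith_iff hj).2 ht⟩

/-! ### Completeness -/

/-- The valuation of the conditionals given by a non-probabilistic model. -/
def NonProbModel.valuation (T : NonProbModel) (a : LCond) : Prop :=
  ∃ t, T.HaltsWith a.antecedent t ∧ a.consequent.Holds fun i => t i = true

/-- A formula that is not derivable from the validities of a class of non-probabilistic models
fails in a uniform mixture of members of the class. -/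
theorem exists_probModel_not_sat {Q : NonProbModel → Prop} {φ : L}
    (hφ : ¬ Derivable (fun ψ => ∀ T, Q T → T.Sat ψ) φ) :
    ∃ M : ProbModel, ¬ M.Sat φ ∧
      ((∀ T, Q T → T.AlwaysHalting) → M.AlmostSurelyHalting) := by
  -- Taking the admissible valuations to be exactly those of models in the class makes every
  -- valuation in the mixture come from such a model.
  have hV : TrueIn (NonProbModel.valuation '' {T | Q T}) = fun ψ => ∀ T, Q T → T.Sat ψ := by
    funext ψ
    exact propext Set.forall_mem_image
  rw [← hV] at hφ
  obtain ⟨ι, _, _, w, hw, hnot⟩ := exists_frequencyValuation_not_holds hφ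
  choose T hQ hT using hw
  obtain ⟨M, hM, hhalt⟩ := exists_probModel_prob_eq T
  refine ⟨M, fun hsat => hnot ?_, fun h => hhalt fun j => h _ (hQ j)⟩
  have hval : ∀ ψ : LNonProb, M.prob ψ =
      (Nat.card {j // ψ.Holds (w j)} : ℝ) / Fintype.card ι := by
    intro ψ
    rw [hM ψ]
    simp only [← hT]
    rfl
  refine (φ.holds_congr fun e _ => ?_).1 hsat
  simp only [frequencyValuation, hval]

end ProbSim

/-- `AX` is sound and complete for the validities over all probabilistic simulation models, and
`AX↓` for those over the almost surely halting ones. -/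
theorem theorem1 :
    (∀ φ : ProbSim.L, ProbSim.AX φ ↔ ProbSim.Valid φ) ∧
    (∀ φ : ProbSim.L, ProbSim.AXHalting φ ↔ ProbSim.ValidHalting φ) := by
  refine ⟨fun φ => ⟨fun h T => h.sound fun ψ hψ => ?_, fun h => ?_⟩,
    fun φ => ⟨fun h T hT => h.sound fun ψ hψ => ?_, fun h => ?_⟩⟩
  · exact .of_forall fun r => ProbSim.ProbModel.satWith_of_nonProbValid hψ T r
  · by_contra hφ
    have hV : ProbSim.NonProbValid = fun ψ => ∀ T : ProbSim.NonProbModel, True → T.Sat ψ := by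
      funext ψ
      simp [ProbSim.NonProbValid]
    rw [ProbSim.AX, hV] at hφ
    obtain ⟨M, hM, -⟩ := ProbSim.exists_probModel_not_sat hφ
    exact hM (h M)
  · exact ProbSim.ProbModel.satWith_of_nonProbValidHalting hψ hT
  · by_contra hφ
    obtain ⟨M, hM, hhalt⟩ :=
      ProbSim.exists_probModel_not_sat (Q := ProbSim.NonProbModel.AlwaysHalting) hφ
    exact hM (h M (hhalt fun _ hT => hT))
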